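/- All manifolds are smooth, finite-dimensional and Hausdorff. Let $G\rightrightarrows Q$ be a Lie groupoid with source and target submersions $\alpha,\beta\colon G\to Q$ and identity section $\epsilon\colon Q\to G$ (the product $gh$ is defined when $\beta(g)=\alpha(h)$). Its Lie algebroid is the vector bundle $AG=\ker(T\alpha)|_{\epsilon(Q)}\to Q$, with fibres $A_qG=\ker T_{\epsilon(q)}\alpha$ and zero section $0_{AG}$. A smooth map $\mathcal R\colon AG\to G$ is called a *generalized discretization map* on $G\rightrightarrows Q$ if $\mathcal R\circ 0_{AG}=\epsilon$ and, for all $q\in Q$ and $v\in A_qG$, with $\mathcal R_q=\mathcal R|_{A_qG}$ and $T_{0}(A_qG)\cong A_qG$, $$T_{0}\mathcal R_q(v)=v+\bigl(T_q\epsilon\circ T_{\epsilon(q)}\alpha\circ T_{0}\mathcal R_q\bigr)(v).$$ Let a Lie group $H$ act smoothly on $G$ and on $Q$ by Lie groupoid automorphisms $(\Phi_h,\phi_h)$, $h\in H$, such that the action on $Q$ is free and proper (then so is the action on $G$), and let $H$ act on $AG$ by the induced maps $A\Phi_h=T\Phi_h|_{AG}$. Let $\mathcal R\colon AG\to G$ be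 a generalized discretization map which is $H$-equivariant, that is, $\mathcal R\circ A\Phi_h=\Phi_h\circ\mathcal R$ for all $h\in H$. Then the quotient manifolds $\widehat G=G/H$ and $\widehat Q=Q/H$ exist: they are Hausdorff and carry smooth structures, of dimensions $\dim G-\dim H$ and $\dim Q-\dim H$ when non-empty, for which the projections $\pi_G\colon G\to\widehat G$ and $\pi_Q\colon Q\to\widehat Q$ are submersions. For any smooth structures on $\widehat G$ and $\widehat Q$ (with the quotient topologies) for which $\pi_G$ and $\pi_Q$ are submersions, the following hold: 1. $\widehat G\rightrightarrows\widehat Q$, with the structural maps induced by those of $G\rightrightarrows Q$, is a Lie groupoid; 2. the map $AG\to A\widehat G$, $v\mapsto T\pi_G(v)$, induces a homeomorphism $AG/H\to A\widehat G$, and a function $f\colon A\widehat G\to\mathbb R$ is smooth if and only if its pull-back to $AG$ is smooth; so $AG/H$ is identified with $A\widehat G$; 3. under this identification the map $\widehat{\mathcal R}\colon AG/H\to G/H$ induced by $\mathcal R$ is a generalized discretization map on $\widehat G\rightrightarrows\widehat Q$. -/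

import Mathlib

open scoped Manifold ContDiff

/-! ### Groupoids and their quotients by free actions -/

/-- A groupoid `G ⇉ Q`, presented by its set `G` of arrows and its base `Q`. An arrow `g` goes from
`src g` to `tgt g`, and `mul g h` is defined when `tgt g = src h`. -/
structure GroupoidOver (G Q : Type*) where
  src : G → Q
  tgt : G → Q
  unit : Q → G
  inv : G → G
  mul : (g h : G) → tgt g = src h → G
  src_mul : ∀ (g h : G) (e : tgt g = src h), src (mul g h e) = src g
  tgt_mul : ∀ (g h : G) (e : tgt g = src h), tgt (mul g h e) = tgt h
  mul_assoc : ∀ (g h k : G) (e₁ : tgt g = src h) (e₂ : tgt h = src k)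
    (e₃ : tgt (mul g h e₁) = src k) (e₄ : tgt g = src (mul h k e₂)),
    mul (mul g h e₁) k e₃ = mul g (mul h k e₂) e₄
  src_unit : ∀ q : Q, src (unit q) = q
  tgt_unit : ∀ q : Q, tgt (unit q) = q
  unit_mul : ∀ (g : G) (e : tgt (unit (src g)) = src g), mul (unit (src g)) g e = g
  mul_unit : ∀ (g : G) (e : tgt g = src (unit (tgt g))), mul g (unit (tgt g)) e = g
  src_inv : ∀ g : G, src (inv g) = tgt g
  tgt_inv : ∀ g : G, tgt (inv g) = src g
  inv_mul : ∀ (g : G) (e : tgt (inv g) = src g), mul (inv g) g e = unit (tgt g)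
  mul_inv : ∀ (g : G) (e : tgt g = src (inv g)), mul g (inv g) e = unit (src g)

namespace GroupoidOver

section Algebra

variable {G Q G' Q' : Type*}

theorem mul_congr (𝒢 : GroupoidOver G Q) {g g' h h' : G} (hg : g = g') (hh : h = h')
    (e : 𝒢.tgt g = 𝒢.src h) (e' : 𝒢.tgt g' = 𝒢.src h') : 𝒢.mul g h e = 𝒢.mul g' h' e' := by
  subst hg hh; rfl

/-- An idempotent arrow is a unit. -/
theorem eq_unit_of_mul_self (𝒢 : GroupoidOver G Q) (g : G) (e : 𝒢.tgt g = 𝒢.src g)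
    (h : 𝒢.mul g g e = g) : g = 𝒢.unit (𝒢.src g) := by
  have e₁ : 𝒢.tgt (𝒢.inv g) = 𝒢.src g := 𝒢.tgt_inv g
  have e₂ : 𝒢.tgt (𝒢.mul (𝒢.inv g) g e₁) = 𝒢.src g := by rw [𝒢.tgt_mul, e]
  have e₃ : 𝒢.tgt (𝒢.inv g) = 𝒢.src (𝒢.mul g g e) := by rw [𝒢.src_mul, e₁]
  have h₁ := 𝒢.mul_assoc (𝒢.inv g) g g e₁ e e₂ e₃
  have h₂ : 𝒢.mul (𝒢.inv g) (𝒢.mul g g e) e₃ = 𝒢.unit (𝒢.tgt g) := by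
    rw [𝒢.mul_congr rfl h e₃ e₁, 𝒢.inv_mul]
  have e₄ : 𝒢.tgt (𝒢.unit (𝒢.src g)) = 𝒢.src g := 𝒢.tgt_unit _
  have h₃ : 𝒢.mul (𝒢.mul (𝒢.inv g) g e₁) g e₂ = g := by
    rw [𝒢.mul_congr (by rw [𝒢.inv_mul, e]) rfl e₂ e₄, 𝒢.unit_mul]
  rw [← h₃, h₁, h₂, e, 𝒢.src_unit]

/-- `(Φ, φ)` is a morphism of groupoids. -/
structure IsHom (𝒢 : GroupoidOver G Q) (𝒢' : GroupoidOver G' Q') (Φ : G → G') (φ : Q → Q') :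
    Prop where
  src : ∀ g, 𝒢'.src (Φ g) = φ (𝒢.src g)
  tgt : ∀ g, 𝒢'.tgt (Φ g) = φ (𝒢.tgt g)
  mul : ∀ (g h : G) (e : 𝒢.tgt g = 𝒢.src h) (e' : 𝒢'.tgt (Φ g) = 𝒢'.src (Φ h)),
    Φ (𝒢.mul g h e) = 𝒢'.mul (Φ g) (Φ h) e'

theorem IsHom.unit {𝒢 : GroupoidOver G Q} {𝒢' : GroupoidOver G' Q'} {Φ : G → G'} {φ : Q → Q'}
    (hΦ : IsHom 𝒢 𝒢' Φ φ) (q : Q) : Φ (𝒢.unit q) = 𝒢'.unit (φ q) := by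
  have hs : 𝒢'.src (Φ (𝒢.unit q)) = φ q := by rw [hΦ.src, 𝒢.src_unit]
  have ht : 𝒢'.tgt (Φ (𝒢.unit q)) = φ q := by rw [hΦ.tgt, 𝒢.tgt_unit]
  have e : 𝒢.tgt (𝒢.unit q) = 𝒢.src (𝒢.unit q) := by rw [𝒢.src_unit, 𝒢.tgt_unit]
  have e₁ : 𝒢.tgt (𝒢.unit (𝒢.src (𝒢.unit q))) = 𝒢.src (𝒢.unit q) := 𝒢.tgt_unit _
  have key : 𝒢.mul (𝒢.unit q) (𝒢.unit q) e = 𝒢.unit q := by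
    rw [𝒢.mul_congr (by rw [𝒢.src_unit]) rfl e e₁, 𝒢.unit_mul]
  have := 𝒢'.eq_unit_of_mul_self (Φ (𝒢.unit q)) (ht.trans hs.symm)
    (by rw [← hΦ.mul _ _ e, key])
  rw [this, hs]

theorem IsHom.inv {𝒢 : GroupoidOver G Q} {𝒢' : GroupoidOver G' Q'} {Φ : G → G'} {φ : Q → Q'}
    (hΦ : IsHom 𝒢 𝒢' Φ φ) (g : G) : Φ (𝒢.inv g) = 𝒢'.inv (Φ g) := by
  have e₀ : 𝒢.tgt (𝒢.inv g) = 𝒢.src g := 𝒢.tgt_inv g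
  have e₁ : 𝒢'.tgt (Φ (𝒢.inv g)) = 𝒢'.src (Φ g) := by rw [hΦ.tgt, hΦ.src, e₀]
  have e₂ : 𝒢'.tgt (Φ g) = 𝒢'.src (𝒢'.inv (Φ g)) := (𝒢'.src_inv _).symm
  have e₃ : 𝒢'.tgt (𝒢'.mul (Φ (𝒢.inv g)) (Φ g) e₁) = 𝒢'.src (𝒢'.inv (Φ g)) := by
    rw [𝒢'.tgt_mul, e₂]
  have e₄ : 𝒢'.tgt (Φ (𝒢.inv g)) = 𝒢'.src (𝒢'.mul (Φ g) (𝒢'.inv (Φ g)) e₂) := by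
    rw [𝒢'.src_mul, e₁]
  have h := 𝒢'.mul_assoc (Φ (𝒢.inv g)) (Φ g) (𝒢'.inv (Φ g)) e₁ e₂ e₃ e₄
  have e₅ : 𝒢'.tgt (Φ (𝒢.inv g)) = 𝒢'.src (𝒢'.unit (𝒢'.tgt (Φ (𝒢.inv g)))) :=
    (𝒢'.src_unit _).symm
  have r : 𝒢'.mul (Φ (𝒢.inv g)) (𝒢'.mul (Φ g) (𝒢'.inv (Φ g)) e₂) e₄ = Φ (𝒢.inv g) := by
    rw [𝒢'.mul_congr rfl (by rw [𝒢'.mul_inv, e₁]) e₄ e₅, 𝒢'.mul_unit]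
  have e₆ : 𝒢'.tgt (𝒢'.unit (𝒢'.src (𝒢'.inv (Φ g)))) = 𝒢'.src (𝒢'.inv (Φ g)) := 𝒢'.tgt_unit _
  have l : 𝒢'.mul (𝒢'.mul (Φ (𝒢.inv g)) (Φ g) e₁) (𝒢'.inv (Φ g)) e₃ = 𝒢'.inv (Φ g) := by
    rw [𝒢'.mul_congr (by rw [← hΦ.mul _ _ e₀, 𝒢.inv_mul, hΦ.unit, 𝒢'.src_inv, hΦ.tgt]) rfl e₃ e₆,
      𝒢'.unit_mul]
  rw [← r, ← h, l]

/-- A group `H` acts on `G ⇉ Q` by groupoid automorphisms. -/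
class IsGroupoidAction (H : Type*) [Group H] [MulAction H G] [MulAction H Q]
    (𝒢 : GroupoidOver G Q) : Prop where
  isHom : ∀ a : H, IsHom 𝒢 𝒢 (fun g => a • g) (fun q => a • q)

section Quotient

open MulAction

variable (H : Type*) [Group H] [MulAction H G] [MulAction H Q]

/-- The projection of `X` onto its orbit space `X / H`. -/
def orbitProj (X : Type*) [MulAction H X] (x : X) : orbitRel.Quotient H X :=
  Quotient.mk (orbitRel H X) x

/-- The map of orbit spaces induced by an `H`-equivariant map. -/
def orbitMap {X Y : Type*} [MulAction H X] [MulAction H Y] (f : X → Y)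
    (hf : ∀ (a : H) (x : X), f (a • x) = a • f x) :
    orbitRel.Quotient H X → orbitRel.Quotient H Y :=
  Quotient.map' f fun x y hxy => by
    obtain ⟨a, ha⟩ := hxy
    exact ⟨a, by rw [← ha]; exact (hf a y).symm⟩

variable {H} in
theorem orbitProj_eq_iff {X : Type*} [MulAction H X] {x y : X} :
    orbitProj H X x = orbitProj H X y ↔ ∃ a : H, a • y = x :=
  Quotient.eq (r := orbitRel H X)

theorem orbitProj_smul {X : Type*} [MulAction H X] (a : H) (x : X) :
    orbitProj H X (a • x) = orbitProj H X x :=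
  orbitProj_eq_iff.2 ⟨a, rfl⟩

theorem orbitProj_surjective (X : Type*) [MulAction H X] :
    Function.Surjective (orbitProj H X) :=
  Quotient.mk_surjective

theorem orbitMap_orbitProj {X Y : Type*} [MulAction H X] [MulAction H Y] (f : X → Y)
    (hf : ∀ (a : H) (x : X), f (a • x) = a • f x) (x : X) :
    orbitMap H f hf (orbitProj H X x) = orbitProj H Y (f x) := rfl

variable (𝒢 : GroupoidOver G Q) [act : IsGroupoidAction H 𝒢]

/-- The source map of the quotient. -/
def quotSrc : orbitRel.Quotient H G → orbitRel.Quotient H Q :=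
  orbitMap H 𝒢.src fun a g => (act.isHom a).src g

/-- The target map of the quotient. -/
def quotTgt : orbitRel.Quotient H G → orbitRel.Quotient H Q :=
  orbitMap H 𝒢.tgt fun a g => (act.isHom a).tgt g

theorem exists_composable (x y : orbitRel.Quotient H G) (e : quotTgt H 𝒢 x = quotSrc H 𝒢 y) :
    ∃ p : G × G, 𝒢.tgt p.1 = 𝒢.src p.2 ∧ orbitProj H G p.1 = x ∧ orbitProj H G p.2 = y := by
  obtain ⟨g, rfl⟩ := orbitProj_surjective H G x
  obtain ⟨h, rfl⟩ := orbitProj_surjective H G y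
  obtain ⟨a, ha⟩ := orbitProj_eq_iff.1 e
  exact ⟨(g, a • h), by rw [(act.isHom a).src, ← ha], rfl, orbitProj_smul H a h⟩

/-- The product of two composable classes: the class of the product of composable
representatives. -/
noncomputable def quotMul (x y : orbitRel.Quotient H G) (e : quotTgt H 𝒢 x = quotSrc H 𝒢 y) :
    orbitRel.Quotient H G :=
  orbitProj H G (𝒢.mul _ _ (exists_composable H 𝒢 x y e).choose_spec.1)

theorem quotMul_congr {x x' y y' : orbitRel.Quotient H G} (hx : x = x') (hy : y = y')
    (e : quotTgt H 𝒢 x = quotSrc H 𝒢 y) (e' : quotTgt H 𝒢 x' = quotSrc H 𝒢 y') :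
    quotMul H 𝒢 x y e = quotMul H 𝒢 x' y' e' := by
  subst hx hy; rfl

variable [IsCancelSMul H Q]

/-- The product does not depend on the composable representatives. -/
theorem quotMul_orbitProj (g h : G) (e : 𝒢.tgt g = 𝒢.src h)
    (e' : quotTgt H 𝒢 (orbitProj H G g) = quotSrc H 𝒢 (orbitProj H G h)) :
    quotMul H 𝒢 (orbitProj H G g) (orbitProj H G h) e' = orbitProj H G (𝒢.mul g h e) := by
  have key := (exists_composable H 𝒢 _ _ e').choose_spec
  have aux : ∀ (g' h' : G) (e₁ : 𝒢.tgt g' = 𝒢.src h'), orbitProj H G g' = orbitProj H G g →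
      orbitProj H G h' = orbitProj H G h →
      orbitProj H G (𝒢.mul g' h' e₁) = orbitProj H G (𝒢.mul g h e) := by
    intro g' h' e₁ h₁ h₂
    obtain ⟨a, rfl⟩ := orbitProj_eq_iff.1 h₁
    obtain ⟨b, rfl⟩ := orbitProj_eq_iff.1 h₂
    have hab : a = b := by
      have h₃ := e₁
      rw [(act.isHom a).tgt, (act.isHom b).src, ← e] at h₃
      exact IsCancelSMul.right_cancel a b _ h₃
    subst hab
    exact orbitProj_eq_iff.2 ⟨a, (act.isHom a).mul g h e e₁⟩
  exact aux _ _ key.1 key.2.1 key.2.2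

theorem quotMul_assoc (x y z : orbitRel.Quotient H G) (e₁ : quotTgt H 𝒢 x = quotSrc H 𝒢 y)
    (e₂ : quotTgt H 𝒢 y = quotSrc H 𝒢 z)
    (e₃ : quotTgt H 𝒢 (quotMul H 𝒢 x y e₁) = quotSrc H 𝒢 z)
    (e₄ : quotTgt H 𝒢 x = quotSrc H 𝒢 (quotMul H 𝒢 y z e₂)) :
    quotMul H 𝒢 (quotMul H 𝒢 x y e₁) z e₃ = quotMul H 𝒢 x (quotMul H 𝒢 y z e₂) e₄ := by
  obtain ⟨⟨g, h⟩, e₅, rfl, rfl⟩ := exists_composable H 𝒢 x y e₁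
  obtain ⟨k', rfl⟩ := orbitProj_surjective H G z
  obtain ⟨a, ha⟩ := orbitProj_eq_iff.1 e₂
  obtain ⟨k, hk⟩ : ∃ k, k = a • k' := ⟨_, rfl⟩
  have hk' : orbitProj H G k' = orbitProj H G k := by rw [hk, orbitProj_smul]
  have e₆ : 𝒢.tgt h = 𝒢.src k := by rw [hk, (act.isHom a).src, ← ha]
  have e₇ : 𝒢.tgt (𝒢.mul g h e₅) = 𝒢.src k := by rw [𝒢.tgt_mul, e₆]
  have e₈ : 𝒢.tgt g = 𝒢.src (𝒢.mul h k e₆) := by rw [𝒢.src_mul]; exact e₅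
  have m₁ : quotMul H 𝒢 (orbitProj H G g) (orbitProj H G h) e₁ = _ :=
    quotMul_orbitProj H 𝒢 g h e₅ e₁
  have m₂ : quotMul H 𝒢 (orbitProj H G h) (orbitProj H G k') e₂ = _ :=
    (quotMul_congr H 𝒢 rfl hk' e₂ (congrArg (orbitProj H Q) e₆)).trans
      (quotMul_orbitProj H 𝒢 h k e₆ _)
  calc _ = quotMul H 𝒢 (orbitProj H G (𝒢.mul g h e₅)) (orbitProj H G k)
          (congrArg (orbitProj H Q) e₇) := quotMul_congr H 𝒢 m₁ hk' _ _
    _ = orbitProj H G (𝒢.mul (𝒢.mul g h e₅) k e₇) := quotMul_orbitProj H 𝒢 _ _ e₇ _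
    _ = orbitProj H G (𝒢.mul g (𝒢.mul h k e₆) e₈) := by rw [𝒢.mul_assoc]
    _ = quotMul H 𝒢 (orbitProj H G g) (orbitProj H G (𝒢.mul h k e₆))
          (congrArg (orbitProj H Q) e₈) := (quotMul_orbitProj H 𝒢 _ _ e₈ _).symm
    _ = _ := (quotMul_congr H 𝒢 rfl m₂ _ _).symm

/-- The quotient groupoid `G / H ⇉ Q / H` of a groupoid by an action by automorphisms which is free
on the base. -/
noncomputable def quotient : GroupoidOver (orbitRel.Quotient H G) (orbitRel.Quotient H Q) where
  src := quotSrc H 𝒢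
  tgt := quotTgt H 𝒢
  unit := orbitMap H 𝒢.unit fun a q => ((act.isHom a).unit q).symm
  inv := orbitMap H 𝒢.inv fun a g => ((act.isHom a).inv g).symm
  mul := quotMul H 𝒢
  src_mul x y e := by
    obtain ⟨⟨g, h⟩, e', rfl, rfl⟩ := exists_composable H 𝒢 x y e
    rw [quotMul_orbitProj H 𝒢 g h e']
    exact congrArg (orbitProj H Q) (𝒢.src_mul g h e')
  tgt_mul x y e := by
    obtain ⟨⟨g, h⟩, e', rfl, rfl⟩ := exists_composable H 𝒢 x y e
    rw [quotMul_orbitProj H 𝒢 g h e']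
    exact congrArg (orbitProj H Q) (𝒢.tgt_mul g h e')
  mul_assoc x y z e₁ e₂ e₃ e₄ := quotMul_assoc H 𝒢 x y z e₁ e₂ e₃ e₄
  src_unit x := by
    obtain ⟨q, rfl⟩ := orbitProj_surjective H Q x
    exact congrArg (orbitProj H Q) (𝒢.src_unit q)
  tgt_unit x := by
    obtain ⟨q, rfl⟩ := orbitProj_surjective H Q x
    exact congrArg (orbitProj H Q) (𝒢.tgt_unit q)
  unit_mul x e := by
    obtain ⟨g, rfl⟩ := orbitProj_surjective H G x
    exact (quotMul_orbitProj H 𝒢 (𝒢.unit (𝒢.src g)) g (𝒢.tgt_unit _) e).trans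
      (congrArg (orbitProj H G) (𝒢.unit_mul g _))
  mul_unit x e := by
    obtain ⟨g, rfl⟩ := orbitProj_surjective H G x
    exact (quotMul_orbitProj H 𝒢 g (𝒢.unit (𝒢.tgt g)) (𝒢.src_unit _).symm e).trans
      (congrArg (orbitProj H G) (𝒢.mul_unit g _))
  src_inv x := by
    obtain ⟨g, rfl⟩ := orbitProj_surjective H G x
    exact congrArg (orbitProj H Q) (𝒢.src_inv g)
  tgt_inv x := by
    obtain ⟨g, rfl⟩ := orbitProj_surjective H G x
    exact congrArg (orbitProj H Q) (𝒢.tgt_inv g)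
  inv_mul x e := by
    obtain ⟨g, rfl⟩ := orbitProj_surjective H G x
    exact (quotMul_orbitProj H 𝒢 (𝒢.inv g) g (𝒢.tgt_inv g) e).trans
      (congrArg (orbitProj H G) (𝒢.inv_mul g _))
  mul_inv x e := by
    obtain ⟨g, rfl⟩ := orbitProj_surjective H G x
    exact (quotMul_orbitProj H 𝒢 g (𝒢.inv g) (𝒢.src_inv g).symm e).trans
      (congrArg (orbitProj H G) (𝒢.mul_inv g _))

/-- The projections form a morphism from `G ⇉ Q` onto `G / H ⇉ Q / H`. -/
theorem isHom_orbitProj : IsHom 𝒢 (𝒢.quotient H) (orbitProj H G) (orbitProj H Q) where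
  src _ := rfl
  tgt _ := rfl
  mul g h e e' := (quotMul_orbitProj H 𝒢 g h e e').symm

end Quotient

end Algebra

end GroupoidOver

/-! ### Lie groupoids, their Lie algebroids, and generalized discretization maps -/

/-- Smoothness of a map `f : S → N` defined on an embedded submanifold `S` of a manifold `M`
(modelled on `I`; `N` is modelled on `J`): near every point of `S`, the map `f` is the restriction
of a smooth map defined on an open subset of `M`. -/
def SmoothOnSubmanifold {E HE F HF M N : Type*} [NormedAddCommGroup E] [NormedSpace ℝ E]
    [TopologicalSpace HE] (I : ModelWithCorners ℝ E HE) [NormedAddCommGroup F] [NormedSpace ℝ F]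
    [TopologicalSpace HF] (J : ModelWithCorners ℝ F HF) [TopologicalSpace M] [ChartedSpace HE M]
    [TopologicalSpace N] [ChartedSpace HF N] (S : Set M) (f : S → N) : Prop :=
  ∀ x : S, ∃ (U : Set M) (F : M → N), IsOpen U ∧ (x : M) ∈ U ∧ ContMDiffOn I J ∞ F U ∧
    ∀ y : S, (y : M) ∈ U → F y = f y

namespace GroupoidOver

section Smooth

variable {G Q G' Q' : Type*} (EG EQ EG' EQ' : Type*)
  [NormedAddCommGroup EG] [NormedSpace ℝ EG] [NormedAddCommGroup EQ] [NormedSpace ℝ EQ]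
  [TopologicalSpace G] [ChartedSpace EG G] [TopologicalSpace Q] [ChartedSpace EQ Q]
  [NormedAddCommGroup EG'] [NormedSpace ℝ EG'] [NormedAddCommGroup EQ'] [NormedSpace ℝ EQ']
  [TopologicalSpace G'] [ChartedSpace EG' G'] [TopologicalSpace Q'] [ChartedSpace EQ' Q']

/-- The set `G₂ ⊆ G × G` of composable pairs. -/
def composable {G Q : Type*} (𝒢 : GroupoidOver G Q) : Set (G × G) :=
  {p | 𝒢.tgt p.1 = 𝒢.src p.2}

/-- The groupoid `G ⇉ Q` over manifolds is a Lie groupoid: the structural maps are smooth, and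
source and target are submersions. -/
class IsLieGroupoid (𝒢 : GroupoidOver G Q) : Prop where
  isSubmersion_src : Manifold.IsSubmersion 𝓘(ℝ, EG) 𝓘(ℝ, EQ) ∞ 𝒢.src
  isSubmersion_tgt : Manifold.IsSubmersion 𝓘(ℝ, EG) 𝓘(ℝ, EQ) ∞ 𝒢.tgt
  contMDiff_unit : ContMDiff 𝓘(ℝ, EQ) 𝓘(ℝ, EG) ∞ 𝒢.unit
  contMDiff_inv : ContMDiff 𝓘(ℝ, EG) 𝓘(ℝ, EG) ∞ 𝒢.inv
  smooth_mul : SmoothOnSubmanifold (𝓘(ℝ, EG).prod 𝓘(ℝ, EG)) 𝓘(ℝ, EG) 𝒢.composable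
    fun p => 𝒢.mul p.1.1 p.1.2 p.2

/-- The total space of the Lie algebroid `AG = ker (Tα)|_{ε(Q)}`: the vectors in `TG` which are
tangent to the source fibres at the units. -/
def algebroid (𝒢 : GroupoidOver G Q) : Set (TangentBundle 𝓘(ℝ, EG) G) :=
  {w | (∃ q, w.proj = 𝒢.unit q) ∧ mfderiv 𝓘(ℝ, EG) 𝓘(ℝ, EQ) 𝒢.src w.proj w.2 = 0}

/-- The differential `T_{ε(q)}α : T_{ε(q)}G → T_qQ`; tangent spaces of `G` and `Q` are copies of
`EG` and `EQ`. -/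
noncomputable def srcDeriv (𝒢 : GroupoidOver G Q) (q : Q) : EG →L[ℝ] EQ :=
  mfderiv 𝓘(ℝ, EG) 𝓘(ℝ, EQ) 𝒢.src (𝒢.unit q)

/-- The differential `T_qε : T_qQ → T_{ε(q)}G`. -/
noncomputable def unitDeriv (𝒢 : GroupoidOver G Q) (q : Q) : EQ →L[ℝ] EG :=
  mfderiv 𝓘(ℝ, EQ) 𝓘(ℝ, EG) 𝒢.unit q

/-- The fibre `A_qG = ker T_{ε(q)}α`, a subspace of `T_{ε(q)}G`. -/
noncomputable def fibre (𝒢 : GroupoidOver G Q) (q : Q) : Submodule ℝ EG :=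
  LinearMap.ker (𝒢.srcDeriv EG EQ q).toLinearMap

/-- The inclusion of the fibre `A_qG` into `AG`. -/
noncomputable def fibreIncl (𝒢 : GroupoidOver G Q) (q : Q) (v : 𝒢.fibre EG EQ q) :
    𝒢.algebroid EG EQ :=
  ⟨⟨𝒢.unit q, (v : EG)⟩, ⟨q, rfl⟩, v.2⟩

/-- The differential `T_0 R_q` of the restriction `R_q` of `R : AG → G` to the fibre `A_qG`, where
`T_0 (A_qG)` is identified with `A_qG` by the vertical lift. -/
noncomputable def fibreDeriv (𝒢 : GroupoidOver G Q) (R : 𝒢.algebroid EG EQ → G) (q : Q) :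
    𝒢.fibre EG EQ q →L[ℝ] EG :=
  mfderiv 𝓘(ℝ, 𝒢.fibre EG EQ q) 𝓘(ℝ, EG) (fun u => R (𝒢.fibreIncl EG EQ q u)) 0

/-- `R : AG → G` is a generalized discretization map on `G ⇉ Q`: it is smooth, `R ∘ 0 = ε`, and
`T_0 R_q (v) = v + (Tε ∘ Tα ∘ T_0 R_q) (v)` for `v ∈ A_qG`. The last equation is one in
`T_{ε(q)}G`, since `R_q (0) = ε(q)` and `α(ε(q)) = q`. -/
structure IsGeneralizedDiscretization [IsManifold 𝓘(ℝ, EG) ∞ G] (𝒢 : GroupoidOver G Q)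
    (R : 𝒢.algebroid EG EQ → G) : Prop where
  smooth : SmoothOnSubmanifold 𝓘(ℝ, EG).tangent 𝓘(ℝ, EG) (𝒢.algebroid EG EQ) R
  zero : ∀ q, R (𝒢.fibreIncl EG EQ q 0) = 𝒢.unit q
  deriv : ∀ (q : Q) (v : 𝒢.fibre EG EQ q), 𝒢.fibreDeriv EG EQ R q v =
    (v : EG) + 𝒢.unitDeriv EG EQ q (𝒢.srcDeriv EG EQ q (𝒢.fibreDeriv EG EQ R q v))

/-- `(Φ, φ)` is a morphism of Lie groupoids. -/
structure IsLieHom (𝒢 : GroupoidOver G Q) (𝒢' : GroupoidOver G' Q') (Φ : G → G') (φ : Q → Q') :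
    Prop extends IsHom 𝒢 𝒢' Φ φ where
  contMDiff_arrows : ContMDiff 𝓘(ℝ, EG) 𝓘(ℝ, EG') ∞ Φ
  contMDiff_base : ContMDiff 𝓘(ℝ, EQ) 𝓘(ℝ, EQ') ∞ φ

variable {EG EQ EG' EQ'}

theorem IsLieGroupoid.mdifferentiable_src {𝒢 : GroupoidOver G Q} [h : IsLieGroupoid EG EQ 𝒢] :
    MDifferentiable 𝓘(ℝ, EG) 𝓘(ℝ, EQ) 𝒢.src :=
  h.isSubmersion_src.contMDiff.mdifferentiable (by simp)

/-- The map `AΦ : AG → AG'`, `v ↦ TΦ(v)`, induced by a morphism of Lie groupoids. -/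
noncomputable def algebroidMap {𝒢 : GroupoidOver G Q} {𝒢' : GroupoidOver G' Q'} [IsLieGroupoid EG EQ 𝒢]
    [IsLieGroupoid EG' EQ' 𝒢'] {Φ : G → G'} {φ : Q → Q'} (hΦ : IsLieHom EG EQ EG' EQ' 𝒢 𝒢' Φ φ)
    (w : 𝒢.algebroid EG EQ) : 𝒢'.algebroid EG' EQ' :=
  ⟨tangentMap 𝓘(ℝ, EG) 𝓘(ℝ, EG') Φ w.1, by
    obtain ⟨⟨p, v⟩, ⟨q, hq⟩, hv⟩ := w
    refine ⟨⟨φ q, ?_⟩, ?_⟩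
    · change Φ p = _
      rw [show p = 𝒢.unit q from hq, hΦ.unit]
    · have hΦd : MDifferentiable 𝓘(ℝ, EG) 𝓘(ℝ, EG') Φ :=
        hΦ.contMDiff_arrows.mdifferentiable (by simp)
      have hφd : MDifferentiable 𝓘(ℝ, EQ) 𝓘(ℝ, EQ') φ :=
        hΦ.contMDiff_base.mdifferentiable (by simp)
      have h₁ := mfderiv_comp p (IsLieGroupoid.mdifferentiable_src (𝒢 := 𝒢') (EG := EG')
        (EQ := EQ') (Φ p)) (hΦd p)
      have h₂ := mfderiv_comp p (hφd (𝒢.src p)) (IsLieGroupoid.mdifferentiable_src (𝒢 := 𝒢)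
        (EG := EG) (EQ := EQ) p)
      have h₃ : 𝒢'.src ∘ Φ = φ ∘ 𝒢.src := funext hΦ.src
      rw [h₃, h₂] at h₁
      have h₄ := DFunLike.congr_fun h₁ v
      refine h₄.symm.trans ?_
      change mfderiv 𝓘(ℝ, EQ) 𝓘(ℝ, EQ') φ (𝒢.src p)
        (mfderiv 𝓘(ℝ, EG) 𝓘(ℝ, EQ) 𝒢.src p v) = 0
      rw [show mfderiv 𝓘(ℝ, EG) 𝓘(ℝ, EQ) 𝒢.src p v = 0 from hv, map_zero]⟩

end Smooth

section Action

open MulAction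

variable {H G Q : Type*} (EH EG EQ : Type*)
  [NormedAddCommGroup EH] [NormedSpace ℝ EH] [TopologicalSpace H] [ChartedSpace EH H] [Group H]
  [NormedAddCommGroup EG] [NormedSpace ℝ EG] [TopologicalSpace G] [ChartedSpace EG G]
  [NormedAddCommGroup EQ] [NormedSpace ℝ EQ] [TopologicalSpace Q] [ChartedSpace EQ Q]
  [MulAction H G] [MulAction H Q]

/-- If `H` acts smoothly by groupoid automorphisms, every `a : H` acts by a morphism `(Φ_a, φ_a)` of
Lie groupoids. -/
theorem isLieHom_smul (𝒢 : GroupoidOver G Q) [act : IsGroupoidAction H 𝒢]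
    [ContMDiffSMul 𝓘(ℝ, EH) 𝓘(ℝ, EG) ∞ H G] [ContMDiffSMul 𝓘(ℝ, EH) 𝓘(ℝ, EQ) ∞ H Q] (a : H) :
    IsLieHom EG EQ EG EQ 𝒢 𝒢 (fun g => a • g) (fun q => a • q) where
  toIsHom := act.isHom a
  contMDiff_arrows := (contMDiff_smul (I := 𝓘(ℝ, EH))).comp (contMDiff_const.prodMk contMDiff_id)
  contMDiff_base := (contMDiff_smul (I := 𝓘(ℝ, EH))).comp (contMDiff_const.prodMk contMDiff_id)

/-- The induced action `a ↦ AΦ_a` of `H` on the Lie algebroid `AG`. -/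
@[reducible]
noncomputable def algebroidAction (𝒢 : GroupoidOver G Q) [IsLieGroupoid EG EQ 𝒢]
    [IsGroupoidAction H 𝒢] [ContMDiffSMul 𝓘(ℝ, EH) 𝓘(ℝ, EG) ∞ H G]
    [ContMDiffSMul 𝓘(ℝ, EH) 𝓘(ℝ, EQ) ∞ H Q] : MulAction H (𝒢.algebroid EG EQ) where
  smul a w := algebroidMap (isLieHom_smul EH EG EQ 𝒢 a) w
  one_smul w := by
    refine Subtype.ext ?_
    change tangentMap 𝓘(ℝ, EG) 𝓘(ℝ, EG) (fun g : G => (1 : H) • g) w.1 = w.1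
    have : (fun g : G => (1 : H) • g) = id := funext fun g => one_smul H g
    rw [this, tangentMap_id]
    rfl
  mul_smul a b w := by
    refine Subtype.ext ?_
    change tangentMap 𝓘(ℝ, EG) 𝓘(ℝ, EG) (fun g : G => (a * b) • g) w.1 =
      tangentMap 𝓘(ℝ, EG) 𝓘(ℝ, EG) (fun g : G => a • g)
        (tangentMap 𝓘(ℝ, EG) 𝓘(ℝ, EG) (fun g : G => b • g) w.1)
    have : (fun g : G => (a * b) • g) = (fun g : G => a • g) ∘ fun g : G => b • g :=
      funext fun g => mul_smul a b g
    rw [this, tangentMap_comp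
      ((isLieHom_smul EH EG EQ 𝒢 a).contMDiff_arrows.mdifferentiable (by simp))
      ((isLieHom_smul EH EG EQ 𝒢 b).contMDiff_arrows.mdifferentiable (by simp))]
    rfl

end Action

section Projection

open MulAction

variable {H G Q : Type*} {EG EQ : Type*} [Group H]
  [NormedAddCommGroup EG] [NormedSpace ℝ EG] [TopologicalSpace G] [ChartedSpace EG G]
  [NormedAddCommGroup EQ] [NormedSpace ℝ EQ] [TopologicalSpace Q] [ChartedSpace EQ Q]
  [MulAction H G] [MulAction H Q]

/-- `(π_G, π_Q)` is a morphism of Lie groupoids whenever the two projections are smooth. -/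
theorem isLieHom_orbitProj (𝒢 : GroupoidOver G Q) [IsGroupoidAction H 𝒢] [IsCancelSMul H Q]
    {EG' EQ' : Type*} [NormedAddCommGroup EG'] [NormedSpace ℝ EG'] [NormedAddCommGroup EQ']
    [NormedSpace ℝ EQ'] [ChartedSpace EG' (orbitRel.Quotient H G)]
    [ChartedSpace EQ' (orbitRel.Quotient H Q)]
    (hG : ContMDiff 𝓘(ℝ, EG) 𝓘(ℝ, EG') ∞ (orbitProj H G))
    (hQ : ContMDiff 𝓘(ℝ, EQ) 𝓘(ℝ, EQ') ∞ (orbitProj H Q)) :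
    IsLieHom EG EQ EG' EQ' 𝒢 (𝒢.quotient H) (orbitProj H G) (orbitProj H Q) where
  toIsHom := isHom_orbitProj H 𝒢
  contMDiff_arrows := hG
  contMDiff_base := hQ

end Projection

end GroupoidOver

/-! ### The inverse function theorem and submersions -/

/-! Since the source map is equivariant, freeness and properness of the action pass from `Q` to `G`,
so both orbit spaces can be treated alike. The orbit map of a free action is immersive at the
identity. Adding complementary directions and applying the inverse function theorem to `(a, v) ↦ a •
s v` yields a local slice, and properness shrinks it until it meets every orbit at most once
(`exists_smoothSlice`). Slices are the charts of the orbit space. They also make the group element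
carrying one point to another a locally smooth function of the two points
(`exists_smooth_division`).

For arbitrary quotient structures with submersive projections, everything descends through local
sections. Division corrects such sections: representatives of a composable pair of classes can be
made composable in a smooth way, which gives smoothness of the product. A section `τ` of `Q → Q / H`
also lifts to a section `σ` of `G → G / H` with `α ∘ σ = τ ∘ α̂` (`exists_section_over`). By
freeness this `σ` sends units to units, and differentiating the relation shows that `Tσ` maps `A(G /
H)` into `AG` (`exists_algebroid_section`).

These maps `Tσ` are local sections of `AG → A(G / H)`. They account for its surjectivity, for the
continuity of the inverse of the induced bijection, and for the descent of smooth functions. The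
fibres are exactly the orbits, because an arrow is locally a smooth function of its source and its
class, so a vector killed by `Tα` and `Tπ_G` vanishes (`eq_zero_of_mfderiv_eq_zero`).

Finally, `Tπ_G` intertwines the endomorphisms `Tε ∘ Tα` and maps `A_qG` onto the corresponding fibre
of `A(G / H)`. Applying it to the identity for `R` gives the identity for the induced map. -/

/-- The inverse function theorem with a smooth inverse on an open set. -/
theorem ContDiffOn.exists_openPartialHomeomorph {E F : Type*} [NormedAddCommGroup E]
    [NormedSpace ℝ E] [CompleteSpace E] [NormedAddCommGroup F] [NormedSpace ℝ F] {f : E → F}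
    {s : Set E} {a : E} (hs : IsOpen s) (hf : ContDiffOn ℝ ∞ f s) (ha : a ∈ s) (f' : E ≃L[ℝ] F)
    (hf' : fderiv ℝ f a = f') :
    ∃ Φ : OpenPartialHomeomorph E F, a ∈ Φ.source ∧ Φ.source ⊆ s ∧ ⇑Φ = f ∧
      ContDiffOn ℝ ∞ Φ.symm Φ.target := by
  have hfa : ContDiffAt ℝ ∞ f a := hf.contDiffAt (hs.mem_nhds ha)
  have hda : HasFDerivAt f (f' : E →L[ℝ] F) a := by
    rw [← hf']; exact (hfa.differentiableAt (by simp)).hasFDerivAt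
  have hcont : ContinuousOn (fderiv ℝ f) s := hf.continuousOn_fderiv_of_isOpen hs (by simp)
  -- The local inverse is restricted to the open locus where the derivative is invertible, so that
  -- it is smooth on its whole domain and not only at the image of `a`.
  have ht : IsOpen (s ∩ fderiv ℝ f ⁻¹' Set.range ((↑) : (E ≃L[ℝ] F) → E →L[ℝ] F)) :=
    hcont.isOpen_inter_preimage hs ContinuousLinearEquiv.isOpen
  refine ⟨(hfa.toOpenPartialHomeomorph f hda (by simp)).restrOpen _ ht,
    ⟨hfa.mem_toOpenPartialHomeomorph_source hda (by simp), ha, f', hf'.symm⟩,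
    fun x hx => hx.2.1, rfl, fun y hy => ?_⟩
  have hy' := OpenPartialHomeomorph.map_target _ hy
  obtain ⟨-, hys, g, hg⟩ := hy'
  have hfy : ContDiffAt ℝ ∞ f _ := hf.contDiffAt (hs.mem_nhds hys)
  refine (OpenPartialHomeomorph.contDiffAt_symm _ hy (f₀' := g) ?_ hfy).contDiffWithinAt
  rw [hg]
  exact (hfy.differentiableAt (by simp)).hasFDerivAt

/-! ### Submersions: normal form, local sections, surjectivity of the differential. -/

section Submersion

variable {E E' M N : Type*} [NormedAddCommGroup E] [NormedSpace ℝ E]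
  [NormedAddCommGroup E'] [NormedSpace ℝ E']
  [TopologicalSpace M] [ChartedSpace E M] [TopologicalSpace N] [ChartedSpace E' N]

/-- A continuous linear surjection of finite-dimensional spaces is a projection `E' × F → E'` up to
a linear isomorphism. -/
theorem ContinuousLinearMap.exists_equiv_prod_of_surjective [FiniteDimensional ℝ E]
    [FiniteDimensional ℝ E'] {F : Type*} [NormedAddCommGroup F] [NormedSpace ℝ F]
    [FiniteDimensional ℝ F] (hF : Module.finrank ℝ F = Module.finrank ℝ E - Module.finrank ℝ E')
    (D : E →L[ℝ] E') (hD : Function.Surjective D) :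
    ∃ (L : E →L[ℝ] F) (T : E ≃L[ℝ] E' × F), ∀ v, T v = (D v, L v) := by
  have hr := LinearMap.finrank_range_add_finrank_ker (D : E →ₗ[ℝ] E')
  rw [LinearMap.range_eq_top.2 hD, finrank_top] at hr
  -- `P` is a linear retraction onto the kernel of `D`. A vector killed by `D` and by `P` is zero,
  -- and the dimensions agree by rank-nullity.
  obtain ⟨P, hP⟩ := (LinearMap.ker (D : E →ₗ[ℝ] E')).subtype.exists_leftInverse_of_injective
    (Submodule.ker_subtype _)
  let e : LinearMap.ker (D : E →ₗ[ℝ] E') ≃ₗ[ℝ] F := LinearEquiv.ofFinrankEq _ _ (by omega)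
  let L : E →ₗ[ℝ] F := e.toLinearMap ∘ₗ P
  let S : E →ₗ[ℝ] E' × F := (D : E →ₗ[ℝ] E').prod L
  have hinj : Function.Injective S := by
    rw [← LinearMap.ker_eq_bot, LinearMap.ker_eq_bot']
    intro v hv
    have h₁ : D v = 0 := congrArg Prod.fst hv
    have h₂ : e (P v) = 0 := congrArg Prod.snd hv
    have h₃ : P v = ⟨v, h₁⟩ := LinearMap.congr_fun hP ⟨v, h₁⟩
    rw [e.map_eq_zero_iff, h₃] at h₂
    exact congrArg Subtype.val h₂
  refine ⟨LinearMap.toContinuousLinearMap L, (LinearEquiv.ofInjectiveOfFinrankEq S hinj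
    (by rw [Module.finrank_prod]; omega)).toContinuousLinearEquiv, fun v => rfl⟩

variable [IsManifold 𝓘(ℝ, E) ∞ M] [IsManifold 𝓘(ℝ, E') ∞ N]

/-- A smooth map in charts is smooth. -/
theorem ContMDiff.contDiffOn_chart {f : M → N} (hf : ContMDiff 𝓘(ℝ, E) 𝓘(ℝ, E') ∞ f) (x : M) (y : N) :
    ContDiffOn ℝ ∞ (chartAt E' y ∘ f ∘ (chartAt E x).symm)
      ((chartAt E x).target ∩ (chartAt E x).symm ⁻¹' (f ⁻¹' (chartAt E' y).source)) := by
  rw [← contMDiffOn_iff_contDiffOn]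
  exact (contMDiffOn_chart (I := 𝓘(ℝ, E')) (x := y) (n := ∞)).comp
    (hf.comp_contMDiffOn ((contMDiffOn_chart_symm (I := 𝓘(ℝ, E)) (n := ∞)).mono
      Set.inter_subset_left)) fun z hz => hz.2

/-- A smooth map with surjective differential at `x` is a submersion at `x`. -/
theorem ContMDiff.isSubmersionAtOfComplement [FiniteDimensional ℝ E] [FiniteDimensional ℝ E']
    {F : Type*} [NormedAddCommGroup F] [NormedSpace ℝ F] [FiniteDimensional ℝ F]
    (hF : Module.finrank ℝ F = Module.finrank ℝ E - Module.finrank ℝ E') {f : M → N}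
    (hf : ContMDiff 𝓘(ℝ, E) 𝓘(ℝ, E') ∞ f) {x : M}
    (hx : Function.Surjective (mfderiv 𝓘(ℝ, E) 𝓘(ℝ, E') f x)) :
    Manifold.IsSubmersionAtOfComplement F 𝓘(ℝ, E) 𝓘(ℝ, E') ∞ f x := by
  have := FiniteDimensional.complete ℝ E
  let f' : E → E' := chartAt E' (f x) ∘ f ∘ (chartAt E x).symm
  have hs := (chartAt E x).isOpen_inter_preimage_symm
    (hf.continuous.isOpen_preimage _ (chartAt E' (f x)).open_source)
  have hf' := ContMDiff.contDiffOn_chart hf x (f x)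
  have hxs : chartAt E x x ∈ (chartAt E x).target ∩
      (chartAt E x).symm ⁻¹' (f ⁻¹' (chartAt E' (f x)).source) := by simp
  have hD : mfderiv 𝓘(ℝ, E) 𝓘(ℝ, E') f x = fderiv ℝ f' (chartAt E x x) := by
    rw [(hf.mdifferentiableAt (by simp)).mfderiv]
    simp only [ModelWithCorners.range_eq_univ, fderivWithin_univ]
    rfl
  obtain ⟨L, T, hT⟩ := ContinuousLinearMap.exists_equiv_prod_of_surjective hF
    (fderiv ℝ f' (chartAt E x x)) (by rw [← hD]; exact hx)
  -- A change of coordinates on the domain that straightens `f'`: by construction the first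
  -- component of `T ∘ Ψ` is `f'`, and the differential of `Ψ` at the base point is the identity.
  let Ψ : E → E := fun e => T.symm (f' e, L e)
  have hΨ : ContDiffOn ℝ ∞ Ψ _ := T.symm.contDiff.comp_contDiffOn
    (hf'.prodMk L.contDiff.contDiffOn)
  obtain ⟨Φ, hΦx, hΦs, hΦ, hΦ'⟩ := hΨ.exists_openPartialHomeomorph hs hxs (.refl ℝ E) (by
    have h₁ : HasFDerivAt f' (fderiv ℝ f' (chartAt E x x)) (chartAt E x x) :=
      ((hf'.contDiffAt (hs.mem_nhds hxs)).differentiableAt (by simp)).hasFDerivAt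
    refine (T.symm.hasFDerivAt.comp (chartAt E x x) (h₁.prodMk L.hasFDerivAt)).fderiv.trans ?_
    ext v
    exact (congrArg T.symm (hT v).symm).trans (T.symm_apply_apply v))
  have hdom : ((chartAt E x).trans Φ) ∈ IsManifold.maximalAtlas 𝓘(ℝ, E) ∞ M := by
    apply OpenPartialHomeomorph.mem_maximalAtlas_of_contMDiffOn
    · refine ContMDiffOn.comp (t := Φ.source) (I' := 𝓘(ℝ, E)) ?_
        ((contMDiffOn_chart (n := ∞)).mono fun z hz => hz.1) fun z hz => hz.2
      exact ((contMDiffOn_iff_contDiffOn.2 hΨ).mono hΦs).congr fun z _ => congrFun hΦ z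
    · exact (contMDiffOn_chart_symm (n := ∞)).comp (I' := 𝓘(ℝ, E))
        ((contMDiffOn_iff_contDiffOn.2 hΦ').mono fun z hz => hz.1) fun z hz => hz.2
  refine Manifold.IsSubmersionAtOfComplement.mk_of_continuousAt hf.continuous.continuousAt T
    ((chartAt E x).trans Φ) (chartAt E' (f x)) ⟨mem_chart_source E x, hΦx⟩
    (mem_chart_source _ _) hdom (IsManifold.chart_mem_maximalAtlas _) fun z hz => ?_
  have hz' : z ∈ Φ.target := by
    have : z ∈ ((chartAt E x).trans Φ).target := by simpa using hz
    exact this.1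
  have h := Φ.right_inv hz'
  rw [hΦ] at h
  exact (congrArg (fun w => (T w).1) h).symm.trans (by simp [Ψ, f']) |>.symm

/-- A smooth map with surjective differentials is a submersion. -/
theorem ContMDiff.isSubmersion [FiniteDimensional ℝ E] [FiniteDimensional ℝ E']
    {f : M → N} (hf : ContMDiff 𝓘(ℝ, E) 𝓘(ℝ, E') ∞ f)
    (h : ∀ x, Function.Surjective (mfderiv 𝓘(ℝ, E) 𝓘(ℝ, E') f x)) :
    Manifold.IsSubmersion 𝓘(ℝ, E) 𝓘(ℝ, E') ∞ f :=
  Manifold.IsSubmersionOfComplement.isSubmersion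
    (F := EuclideanSpace ℝ (Fin (Module.finrank ℝ E - Module.finrank ℝ E')))
    fun x => hf.isSubmersionAtOfComplement (by simp) (h x)

omit [IsManifold 𝓘(ℝ, E) ∞ M] [IsManifold 𝓘(ℝ, E') ∞ N] in
/-- A submersion has smooth local sections through every point. -/
theorem Manifold.IsSubmersionAt.exists_section {f : M → N} {x : M}
    (hf : Manifold.IsSubmersionAt 𝓘(ℝ, E) 𝓘(ℝ, E') ∞ f x) :
    ∃ (U : Set N) (σ : N → M), IsOpen U ∧ f x ∈ U ∧ ContMDiffOn 𝓘(ℝ, E') 𝓘(ℝ, E) ∞ σ U ∧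
      σ (f x) = x ∧ ∀ y ∈ U, f (σ y) = y := by
  let c := hf.equiv (hf.domChart x)
  have hfx := hf.mem_codChart_source
  have hx := hf.mem_domChart_source
  -- In the charts where `f` is a linear projection, the section keeps the complementary coordinate
  -- frozen at its value `c.2` at `x`.
  let τ : E' → E := fun z => hf.equiv.symm (z, c.2)
  have hτ : ContDiff ℝ ∞ τ := hf.equiv.symm.contDiff.comp (contDiff_id.prodMk contDiff_const)
  have key : ∀ z ∈ hf.domChart.target, hf.codChart (f (hf.domChart.symm z)) = (hf.equiv z).1 :=
    fun z hz => by
      have : z ∈ (hf.domChart.extend 𝓘(ℝ, E)).target := by simpa using hz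
      simpa using hf.writtenInCharts this
  have h₀ : τ (hf.codChart (f x)) = hf.domChart x := by
    have := key _ (hf.domChart.map_source hx)
    rw [hf.domChart.left_inv hx] at this
    simp [τ, this, c]
  have hU := hf.codChart.isOpen_inter_preimage (hf.domChart.open_target.preimage hτ.continuous)
  refine ⟨_, fun y => hf.domChart.symm (τ (hf.codChart y)), hU, ⟨hfx, ?_⟩, ?_, ?_, ?_⟩
  · rw [Set.mem_preimage, Set.mem_preimage, h₀]
    exact hf.domChart.map_source hx
  · refine (contMDiffOn_symm_of_mem_maximalAtlas hf.domChart_mem_maximalAtlas).comp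
      (hτ.contMDiff.comp_contMDiffOn ((contMDiffOn_of_mem_maximalAtlas
        hf.codChart_mem_maximalAtlas).mono Set.inter_subset_left)) fun z hz => hz.2
  · simp only [h₀, hf.domChart.left_inv hx]
  · rintro y ⟨hy, hy'⟩
    refine hf.codChart.injOn (hf.source_subset_preimage_source (hf.domChart.map_target hy')) hy ?_
    rw [key _ hy']
    simp [τ]

omit [IsManifold 𝓘(ℝ, E) ∞ M] [IsManifold 𝓘(ℝ, E') ∞ N] in
/-- A differentiable map with a differentiable local section through `x` has surjective
differential at `x`. -/
theorem MDifferentiableAt.surjective_mfderiv_of_section {f : M → N} {x : M}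
    (hf : MDifferentiableAt 𝓘(ℝ, E) 𝓘(ℝ, E') f x) {σ : N → M}
    (hσ : MDifferentiableAt 𝓘(ℝ, E') 𝓘(ℝ, E) σ (f x)) (hx : σ (f x) = x)
    (h : ∀ᶠ y in nhds (f x), f (σ y) = y) :
    Function.Surjective (mfderiv 𝓘(ℝ, E) 𝓘(ℝ, E') f x) := by
  have h₁ : mfderiv 𝓘(ℝ, E') 𝓘(ℝ, E') (f ∘ σ) (f x) = ContinuousLinearMap.id ℝ _ := by
    rw [Filter.EventuallyEq.mfderiv_eq (show f ∘ σ =ᶠ[nhds (f x)] id from h), mfderiv_id]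
  rw [mfderiv_comp (I' := 𝓘(ℝ, E)) (f x) (by rwa [hx]) hσ] at h₁
  have h₂ : (mfderiv 𝓘(ℝ, E) 𝓘(ℝ, E') f x : E →L[ℝ] E') =
      mfderiv 𝓘(ℝ, E) 𝓘(ℝ, E') f (σ (f x)) := by rw [hx]
  exact fun w => ⟨mfderiv 𝓘(ℝ, E') 𝓘(ℝ, E) σ (f x) w,
    (DFunLike.congr_fun h₂ _).trans (DFunLike.congr_fun h₁ w)⟩

omit [IsManifold 𝓘(ℝ, E) ∞ M] [IsManifold 𝓘(ℝ, E') ∞ N] in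
/-- The differential of a submersion is surjective. -/
theorem Manifold.IsSubmersionAt.surjective_mfderiv {f : M → N} {x : M}
    (hf : Manifold.IsSubmersionAt 𝓘(ℝ, E) 𝓘(ℝ, E') ∞ f x) :
    Function.Surjective (mfderiv 𝓘(ℝ, E) 𝓘(ℝ, E') f x) := by
  obtain ⟨U, σ, hU, hxU, hσ, hx, h⟩ := hf.exists_section
  exact (hf.contMDiffAt.mdifferentiableAt (by simp)).surjective_mfderiv_of_section
    ((hσ.contMDiffAt (hU.mem_nhds hxU)).mdifferentiableAt (by simp)) hx
    (Filter.eventually_of_mem (hU.mem_nhds hxU) h)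

end Submersion

/-! ### Free proper actions: slices and quotient manifolds -/

/-- A curve with vanishing derivative near `t` is constant near `t`. -/
theorem eventually_eq_const_of_hasMFDerivAt_zero {E X : Type*} [NormedAddCommGroup E]
    [NormedSpace ℝ E] [TopologicalSpace X] [ChartedSpace E X] [IsManifold 𝓘(ℝ, E) ∞ X] {c : ℝ → X} {t : ℝ}
    (hc : ∀ᶠ s in nhds t, HasMFDerivAt 𝓘(ℝ, ℝ) 𝓘(ℝ, E) c s 0) : ∀ᶠ s in nhds t, c s = c t := by
  have hct : ContinuousAt c t := hc.self_of_nhds.continuousAt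
  have hsrc : ∀ᶠ s in nhds t, c s ∈ (chartAt E (c t)).source :=
    hct.eventually ((chartAt E (c t)).open_source.mem_nhds (mem_chart_source E _))
  obtain ⟨ε, hε, h⟩ := Metric.eventually_nhds_iff_ball.1 (hc.and hsrc)
  have hd : ∀ s ∈ Metric.ball t ε, HasFDerivAt (chartAt E (c t) ∘ c) (0 : ℝ →L[ℝ] E) s := by
    intro s hs
    have h₁ : MDifferentiableAt 𝓘(ℝ, E) 𝓘(ℝ, E) (chartAt E (c t)) (c s) :=
      (contMDiffAt_of_mem_maximalAtlas (IsManifold.chart_mem_maximalAtlas (n := ∞) _)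
        (h s hs).2).mdifferentiableAt (by simp)
    have h₂ := h₁.hasMFDerivAt.comp s (h s hs).1
    rw [ContinuousLinearMap.comp_zero] at h₂
    exact hasMFDerivAt_iff_hasFDerivAt.1 h₂
  filter_upwards [Metric.ball_mem_nhds t hε] with s hs
  have := (convex_ball t ε).is_const_of_fderivWithin_eq_zero (𝕜 := ℝ)
    (fun s hs => (hd s hs).differentiableAt.differentiableWithinAt) (fun s hs => by
      rw [fderivWithin_of_isOpen Metric.isOpen_ball hs, (hd s hs).fderiv]) hs
    (Metric.mem_ball_self hε)
  exact (chartAt E (c t)).injOn (h s hs).2 (mem_chart_source E _) this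

theorem contMDiff_smul_left (EH E : Type*) {H X : Type*}
    [NormedAddCommGroup EH] [NormedSpace ℝ EH] [NormedAddCommGroup E] [NormedSpace ℝ E]
    [TopologicalSpace H] [ChartedSpace EH H] [TopologicalSpace X] [ChartedSpace E X] [SMul H X]
    [ContMDiffSMul 𝓘(ℝ, EH) 𝓘(ℝ, E) ∞ H X] (a : H) :
    ContMDiff 𝓘(ℝ, E) 𝓘(ℝ, E) ∞ (fun x : X => a • x) :=
  (contMDiff_smul (I := 𝓘(ℝ, EH)) (I' := 𝓘(ℝ, E))).comp (contMDiff_const.prodMk contMDiff_id)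

/-! ### Orbit maps of free actions. -/

section OrbitMap

variable {H X EH E : Type*}
  [NormedAddCommGroup EH] [NormedSpace ℝ EH] [NormedAddCommGroup E] [NormedSpace ℝ E]
  [Group H] [TopologicalSpace H] [ChartedSpace EH H]
  [TopologicalSpace X] [ChartedSpace E X]
  [MulAction H X] [ContMDiffSMul 𝓘(ℝ, EH) 𝓘(ℝ, E) ∞ H X]

variable (EH E) in
theorem contMDiff_smul_right (x : X) : ContMDiff 𝓘(ℝ, EH) 𝓘(ℝ, E) ∞ (fun a : H => a • x) :=
  (contMDiff_smul (I := 𝓘(ℝ, EH)) (I' := 𝓘(ℝ, E))).comp (contMDiff_id.prodMk contMDiff_const)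

/-- The orbit maps of a free action are immersions at the identity. -/
theorem injective_mfderiv_smul_right [CompleteSpace EH] [LieGroup 𝓘(ℝ, EH) ∞ H]
    [IsManifold 𝓘(ℝ, E) ∞ X] [IsCancelSMul H X] (x : X) :
    Function.Injective (mfderiv 𝓘(ℝ, EH) 𝓘(ℝ, E) (fun a : H => a • x) 1) := by
  have hL : LieGroup 𝓘(ℝ, EH) (minSmoothness ℝ 3) H :=
    LieGroup.of_le (n := ∞) (by rw [minSmoothness_of_isRCLikeNormedField]; exact ENat.LEInfty.out)
  have hM : IsManifold 𝓘(ℝ, EH) 1 H := IsManifold.of_le (n := ∞) (by simp)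
  rw [injective_iff_map_eq_zero]
  intro v hv
  -- A kernel vector `v` is extended to a left-invariant field `V`. By equivariance the differential
  -- of the orbit map kills `V` everywhere, so an integral curve through `1` is sent to a constant
  -- curve in `X`. Freeness makes the curve itself constant near `0`, hence `v = 0`.
  let V : ∀ g : H, TangentSpace 𝓘(ℝ, EH) g := mulInvariantVectorField (I := 𝓘(ℝ, EH)) v
  have hV : ContMDiffAt 𝓘(ℝ, EH) 𝓘(ℝ, EH).tangent 1
      (fun g => (⟨g, V g⟩ : TangentBundle 𝓘(ℝ, EH) H)) 1 :=
    (contMDiffAt_mulInvariantVectorField v).of_le (by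
      rw [minSmoothness_of_isRCLikeNormedField]; exact one_le_two)
  obtain ⟨γ, hγ₀, hγ⟩ := exists_isMIntegralCurveAt_of_contMDiffAt_boundaryless 0 hV
  have ho : ∀ a : H, MDifferentiableAt 𝓘(ℝ, EH) 𝓘(ℝ, E) (fun a : H => a • x) a := fun a =>
    (contMDiff_smul_right EH E x).mdifferentiableAt (by simp)
  have hl : ∀ (a : H) (y : X), MDifferentiableAt 𝓘(ℝ, E) 𝓘(ℝ, E) (fun y : X => a • y) y :=
    fun a y => (contMDiff_smul_left EH E a).mdifferentiableAt (by simp)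
  have hm : ∀ (a b : H), MDifferentiableAt 𝓘(ℝ, EH) 𝓘(ℝ, EH) (fun b : H => a * b) b :=
    fun a b => (contMDiff_mul_left (I := 𝓘(ℝ, EH)) (n := ∞) (G := H)).mdifferentiableAt (by simp)
  have hz : ∀ g : H, mfderiv 𝓘(ℝ, EH) 𝓘(ℝ, E) (fun a : H => a • x) g (V g) = 0 := by
    intro g
    have h₁ : (fun a : H => a • x) ∘ (fun b : H => g * b) =
        (fun y : X => g • y) ∘ (fun a : H => a • x) := funext fun b => mul_smul g b x
    have h₂ := mfderiv_comp (1 : H) (hl g _) (ho 1)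
    rw [← h₁, mfderiv_comp (1 : H) (ho (g * 1)) (hm g 1)] at h₂
    have h₃ := DFunLike.congr_fun h₂ v
    have h₄ : (mfderiv 𝓘(ℝ, EH) 𝓘(ℝ, E) (fun a : H => a • x) (g * 1) : EH →L[ℝ] E) =
      mfderiv 𝓘(ℝ, EH) 𝓘(ℝ, E) (fun a : H => a • x) g := by rw [mul_one]
    refine (DFunLike.congr_fun h₄ _).symm.trans (h₃.trans ?_)
    exact (congrArg (mfderiv 𝓘(ℝ, E) 𝓘(ℝ, E) (fun y : X => g • y) ((1 : H) • x)) hv).trans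
      (map_zero _)
  have hzero : ∀ (A : EH →L[ℝ] E) (w : EH), A w = 0 →
      A.comp ((1 : ℝ →L[ℝ] ℝ).smulRight w) = 0 := fun A w h => by
    ext
    simp [h]
  have hconst : ∀ᶠ t in nhds (0 : ℝ), γ t • x = γ 0 • x := by
    refine eventually_eq_const_of_hasMFDerivAt_zero (E := E) (c := fun t => γ t • x) ?_
    filter_upwards [hγ] with t ht
    refine ((ho (γ t)).hasMFDerivAt.comp t ht).congr_mfderiv ?_
    exact hzero _ _ (hz (γ t))
  have hγc : γ =ᶠ[nhds 0] fun _ => (1 : H) := by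
    filter_upwards [hconst] with t ht
    rw [← hγ₀]
    exact IsCancelSMul.right_cancel _ _ _ ht
  have h₁ := (hγ.hasMFDerivAt.congr_of_eventuallyEq hγc.symm)
  have h₂ := hasMFDerivAt_unique h₁ (hasMFDerivAt_const (1 : H) (0 : ℝ))
  have h₃ : V (γ 0) = 0 := by
    have := DFunLike.congr_fun h₂ (1 : ℝ)
    exact (one_smul ℝ _).symm.trans this
  rw [hγ₀] at h₃
  have h₄ : V 1 = v := by
    change mfderiv 𝓘(ℝ, EH) 𝓘(ℝ, EH) (fun b : H => 1 * b) 1 v = v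
    have : (fun b : H => 1 * b) = id := funext fun b => one_mul b
    rw [this, mfderiv_id]
    rfl
  exact h₄.symm.trans h₃

end OrbitMap

/-! ### Local slices of free proper actions. -/

section Slice

/-- For a free proper action, group elements moving a point close to `x` to a point close to `x`
are close to the identity. -/
theorem exists_isOpen_forall_smul_mem {H X : Type*} [Group H] [TopologicalSpace H]
    [TopologicalSpace X] [MulAction H X] [ProperSMul H X] [IsCancelSMul H X] {N : Set H}
    (hN : IsOpen N) (h1 : 1 ∈ N) (x : X) :
    ∃ W : Set X, IsOpen W ∧ x ∈ W ∧ ∀ (a : H), ∀ w ∈ W, a • w ∈ W → a ∈ N := by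
  -- A proper map is closed, so the pairs `(a • w, w)` with `a ∉ N` form a closed set. By freeness
  -- it misses `(x, x)`, and a product neighbourhood avoiding it gives `W`.
  have hC : IsClosed ((fun p : H × X => (p.1 • p.2, p.2)) '' (Nᶜ ×ˢ Set.univ)) :=
    (ProperSMul.isProperMap_smul_pair (G := H) (X := X)).isClosedMap _
      (hN.isClosed_compl.prod isClosed_univ)
  have hx : (x, x) ∉ (fun p : H × X => (p.1 • p.2, p.2)) '' (Nᶜ ×ˢ Set.univ) := by
    rintro ⟨⟨a, w⟩, ⟨ha, -⟩, h⟩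
    obtain ⟨h₁, rfl⟩ := Prod.mk.inj h
    exact ha (by rwa [IsCancelSMul.right_cancel a 1 w (h₁.trans (one_smul H w).symm)])
  obtain ⟨W₁, W₂, hW₁, hW₂, hx₁, hx₂, h⟩ := isOpen_prod_iff.1 hC.isOpen_compl x x hx
  refine ⟨W₁ ∩ W₂, hW₁.inter hW₂, ⟨hx₁, hx₂⟩, fun a w hw haw => ?_⟩
  by_contra ha
  exact h (Set.mk_mem_prod haw.1 hw.2) ⟨(a, w), ⟨ha, trivial⟩, rfl⟩

/-- A complement of the range of `A` has the dimension of `F`, so `F` can be identified with it. In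
the slice construction `A` spans the directions of the orbit and `L` the transverse ones. -/
theorem ContinuousLinearMap.exists_equiv_prod_of_injective {E₁ E F : Type*}
    [NormedAddCommGroup E₁] [NormedSpace ℝ E₁] [FiniteDimensional ℝ E₁]
    [NormedAddCommGroup E] [NormedSpace ℝ E] [FiniteDimensional ℝ E]
    [NormedAddCommGroup F] [NormedSpace ℝ F] [FiniteDimensional ℝ F]
    (hF : Module.finrank ℝ F = Module.finrank ℝ E - Module.finrank ℝ E₁)
    (A : E₁ →L[ℝ] E) (hA : Function.Injective A) :
    ∃ (L : F →L[ℝ] E) (T : (E₁ × F) ≃L[ℝ] E), ∀ p, T p = A p.1 + L p.2 := by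
  obtain ⟨C, hC⟩ := Submodule.exists_isCompl (LinearMap.range (A : E₁ →ₗ[ℝ] E))
  have hr : Module.finrank ℝ (LinearMap.range (A : E₁ →ₗ[ℝ] E)) = Module.finrank ℝ E₁ :=
    LinearMap.finrank_range_of_inj hA
  have hs := Submodule.finrank_add_eq_of_isCompl hC
  let e : F ≃ₗ[ℝ] C := LinearEquiv.ofFinrankEq _ _ (by omega)
  let L : F →ₗ[ℝ] E := C.subtype ∘ₗ e.toLinearMap
  let S : E₁ × F →ₗ[ℝ] E := (A : E₁ →ₗ[ℝ] E).coprod L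
  have hinj : Function.Injective S := by
    rw [← LinearMap.ker_eq_bot, LinearMap.ker_eq_bot']
    rintro ⟨a, v⟩ h
    have h₁ : A a + L v = 0 := by simpa [S] using h
    have h₂ : A a ∈ LinearMap.range (A : E₁ →ₗ[ℝ] E) ⊓ C := by
      refine ⟨⟨a, rfl⟩, ?_⟩
      rw [eq_neg_of_add_eq_zero_left h₁]
      exact C.neg_mem (e v).2
    rw [hC.inf_eq_bot, Submodule.mem_bot] at h₂
    rw [h₂, zero_add] at h₁
    have h₃ : e v = 0 := Subtype.ext h₁
    rw [e.map_eq_zero_iff] at h₃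
    exact Prod.ext (hA (h₂.trans (map_zero A).symm)) h₃
  exact ⟨LinearMap.toContinuousLinearMap L, (LinearEquiv.ofInjectiveOfFinrankEq S hinj
    (by rw [Module.finrank_prod]; omega)).toContinuousLinearEquiv, fun p => rfl⟩

/-- A smooth local slice of an action of `H` on `X`: every point `u` of the open set `U` is moved by
`shift u` from the point with parameter `param u` of the slice `slice : V → U`, and `param`
is constant on the intersections of the orbits with `U`. -/
structure SmoothSlice (EH E F H X : Type*)
    [NormedAddCommGroup EH] [NormedSpace ℝ EH] [NormedAddCommGroup E] [NormedSpace ℝ E]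
    [NormedAddCommGroup F] [NormedSpace ℝ F]
    [Group H] [TopologicalSpace H] [ChartedSpace EH H]
    [TopologicalSpace X] [ChartedSpace E X] [MulAction H X] where
  U : Set X
  V : Set F
  shift : X → H
  param : X → F
  slice : F → X
  isOpen_U : IsOpen U
  isOpen_V : IsOpen V
  contMDiffOn_shift : ContMDiffOn 𝓘(ℝ, E) 𝓘(ℝ, EH) ∞ shift U
  contMDiffOn_param : ContMDiffOn 𝓘(ℝ, E) 𝓘(ℝ, F) ∞ param U
  contMDiffOn_slice : ContMDiffOn 𝓘(ℝ, F) 𝓘(ℝ, E) ∞ slice V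
  mapsTo_param : Set.MapsTo param U V
  mapsTo_slice : Set.MapsTo slice V U
  param_slice : ∀ v ∈ V, param (slice v) = v
  shift_smul_slice : ∀ u ∈ U, shift u • slice (param u) = u
  param_smul : ∀ (a : H), ∀ u ∈ U, a • u ∈ U → param (a • u) = param u

variable {EH E F H X : Type*}
  [NormedAddCommGroup EH] [NormedSpace ℝ EH]
  [NormedAddCommGroup E] [NormedSpace ℝ E]
  [NormedAddCommGroup F] [NormedSpace ℝ F]
  [Group H] [TopologicalSpace H] [ChartedSpace EH H]
  [TopologicalSpace X] [ChartedSpace E X] [MulAction H X]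

/-- Both group elements move the same slice point to `a • u`, and freeness cancels that point. This
equivariance is what makes the quotient of two shifts a division map. -/
theorem SmoothSlice.shift_smul [IsCancelSMul H X] (S : SmoothSlice EH E F H X) (a : H) {u : X}
    (hu : u ∈ S.U) (hau : a • u ∈ S.U) : S.shift (a • u) = a * S.shift u := by
  refine IsCancelSMul.right_cancel _ _ (S.slice (S.param u)) ?_
  rw [mul_smul, S.shift_smul_slice u hu, ← S.param_smul a u hu hau, S.shift_smul_slice _ hau]

/-- A free proper smooth action has smooth slices through every point. -/
theorem exists_smoothSlice [FiniteDimensional ℝ EH] [FiniteDimensional ℝ E]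
    [FiniteDimensional ℝ F] [LieGroup 𝓘(ℝ, EH) ∞ H] [IsManifold 𝓘(ℝ, E) ∞ X]
    [ContMDiffSMul 𝓘(ℝ, EH) 𝓘(ℝ, E) ∞ H X] [ProperSMul H X] [IsCancelSMul H X]
    (hF : Module.finrank ℝ F = Module.finrank ℝ E - Module.finrank ℝ EH) (x : X) :
    ∃ S : SmoothSlice EH E F H X, x ∈ S.U := by
  have := FiniteDimensional.complete ℝ EH
  have := FiniteDimensional.complete ℝ E
  have := FiniteDimensional.complete ℝ F
  let φ := chartAt E x
  let ψ := chartAt EH (1 : H)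
  have hφx : x ∈ φ.source := mem_chart_source E x
  have hψ1 : (1 : H) ∈ ψ.source := mem_chart_source EH 1
  obtain ⟨L, T, hT⟩ := ContinuousLinearMap.exists_equiv_prod_of_injective hF
    (mfderiv 𝓘(ℝ, EH) 𝓘(ℝ, E) (fun a : H => a • x) 1) (injective_mfderiv_smul_right x)
  -- In the chart at `x`, the candidate slice is the affine subspace through `φ x` in the directions
  -- of `L`, transverse to the orbit.
  let ℓ : F → E := fun v => φ x + L v
  have hℓ : ContDiff ℝ ∞ ℓ := contDiff_const.add L.contDiff
  let s : F → X := fun v => φ.symm (ℓ v)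
  have hs₀ : s 0 = x := by simp [s, ℓ, φ]
  let B : Set F := ℓ ⁻¹' φ.target
  have hB : IsOpen B := φ.open_target.preimage hℓ.continuous
  have h0B : (0 : F) ∈ B := by simp [B, ℓ, φ]
  have hs : ContMDiffOn 𝓘(ℝ, F) 𝓘(ℝ, E) ∞ s B :=
    (contMDiffOn_chart_symm (I := 𝓘(ℝ, E)) (n := ∞)).comp hℓ.contMDiff.contMDiffOn fun z hz => hz
  have hφs : ∀ v ∈ B, φ (s v) = ℓ v := fun v hv => φ.right_inv hv
  have hsφ : ∀ v ∈ B, s v ∈ φ.source := fun v hv => φ.map_target hv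
  -- The action restricted to the slice. Read in charts, its differential at `(ψ 1, 0)` is `T`: the
  -- orbit map gives the first block and `L` the second, so the inverse function theorem applies.
  let g : EH × F → X := fun p => ψ.symm p.1 • s p.2
  have hg : ContMDiffOn 𝓘(ℝ, EH × F) 𝓘(ℝ, E) ∞ g (ψ.target ×ˢ B) :=
    (contMDiff_smul (I := 𝓘(ℝ, EH)) (I' := 𝓘(ℝ, E)) (n := ∞)).comp_contMDiffOn
      (((contMDiffOn_chart_symm (I := 𝓘(ℝ, EH)) (n := ∞)).comp
        contDiff_fst.contMDiff.contMDiffOn fun z hz => hz.1).prodMk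
      (hs.comp contDiff_snd.contMDiff.contMDiffOn fun z hz => hz.2))
  let D := (ψ.target ×ˢ B) ∩ g ⁻¹' φ.source
  have hD : IsOpen D :=
    hg.continuousOn.isOpen_inter_preimage (ψ.open_target.prod hB) φ.open_source
  have hg₁ : ∀ v, g (ψ 1, v) = s v := fun v => by simp [g, ψ.left_inv hψ1]
  have hp₀ : (ψ 1, (0 : F)) ∈ D := ⟨⟨ψ.map_source hψ1, h0B⟩, by
    rw [Set.mem_preimage, hg₁, hs₀]; exact hφx⟩
  have hf : ContDiffOn ℝ ∞ (φ ∘ g) D := by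
    rw [← contMDiffOn_iff_contDiffOn]
    exact (contMDiffOn_chart (I := 𝓘(ℝ, E)) (n := ∞)).comp (hg.mono Set.inter_subset_left)
      fun z hz => hz.2
  have hfd : HasFDerivAt (φ ∘ g) (fderiv ℝ (φ ∘ g) (ψ 1, 0)) (ψ 1, (0 : F)) :=
    ((hf.contDiffAt (hD.mem_nhds hp₀)).differentiableAt (by simp)).hasFDerivAt
  have h₁ : ∀ a, fderiv ℝ (φ ∘ g) (ψ 1, 0) (a, 0) =
      mfderiv 𝓘(ℝ, EH) 𝓘(ℝ, E) (fun a : H => a • x) 1 a := by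
    have h₂ : HasFDerivAt (fun a : EH => φ (g (a, 0))) _ (ψ 1) :=
      HasFDerivAt.comp (g := φ ∘ g) (ψ 1) hfd (hasFDerivAt_prodMk_left (ψ 1) (0 : F))
    have h₃ : (mfderiv 𝓘(ℝ, EH) 𝓘(ℝ, E) (fun a : H => a • x) 1 : EH →L[ℝ] E) =
        fderiv ℝ (chartAt E ((1 : H) • x) ∘ (fun a : H => a • x) ∘ ψ.symm) (ψ 1) := by
      rw [((contMDiff_smul_right EH E x).mdifferentiableAt (by simp)).mfderiv]
      simp only [ModelWithCorners.range_eq_univ, fderivWithin_univ]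
      rfl
    have h₄ : (chartAt E ((1 : H) • x) ∘ (fun a : H => a • x) ∘ ψ.symm) =
        fun a : EH => φ (g (a, 0)) := by
      rw [one_smul]
      funext a
      simp [g, hs₀, φ]
    rw [h₄, h₂.fderiv] at h₃
    exact fun a => (DFunLike.congr_fun h₃ a).symm
  have h₂ : ∀ v, fderiv ℝ (φ ∘ g) (ψ 1, 0) (0, v) = L v := by
    have h₂ : HasFDerivAt (fun v : F => φ (g (ψ 1, v))) _ 0 :=
      HasFDerivAt.comp (g := φ ∘ g) (0 : F) hfd (hasFDerivAt_prodMk_right (ψ 1) (0 : F))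
    have h₃ : HasFDerivAt (fun v : F => φ (g (ψ 1, v))) L 0 := by
      refine (L.hasFDerivAt.const_add (φ x)).congr_of_eventuallyEq ?_
      filter_upwards [hB.mem_nhds h0B] with v hv
      rw [hg₁, hφs v hv]
    exact fun v => DFunLike.congr_fun (h₂.unique h₃) v
  obtain ⟨Φ, hΦp, hΦD, hΦ, hΦ'⟩ := hf.exists_openPartialHomeomorph hD hp₀ T (by
    refine ContinuousLinearMap.ext fun p => ?_
    have h₃ : p = (p.1, 0) + (0, p.2) := by simp
    refine Eq.trans ?_ (hT p).symm
    conv_lhs => rw [h₃, map_add, h₁, h₂]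
    rfl)
  obtain ⟨A₀, V₀, hA₀, hV₀, h1A, h0V, hAV⟩ := isOpen_prod_iff.1 Φ.open_source _ _ hΦp
  -- Local invertibility does not prevent an orbit from returning to the slice by a distant group
  -- element. Properness excludes this: only elements with coordinates in `A₀` move a point of `W`
  -- into `W`.
  obtain ⟨W, hW, hxW, hWN⟩ := exists_isOpen_forall_smul_mem
    (ψ.isOpen_inter_preimage hA₀) ⟨hψ1, h1A⟩ x
  have hV₀B : V₀ ⊆ B := fun v hv => (hΦD (hAV (Set.mk_mem_prod h1A hv))).1.2
  let V := V₀ ∩ s ⁻¹' W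
  have hV : IsOpen V := (hs.mono hV₀B).continuousOn.isOpen_inter_preimage hV₀ hW
  let U := φ.source ∩ φ ⁻¹' (Φ.target ∩ Φ.symm ⁻¹' (A₀ ×ˢ V))
  have hU : IsOpen U := φ.isOpen_inter_preimage (Φ.isOpen_inter_preimage_symm (hA₀.prod hV))
  have hΦsymm : ContMDiffOn 𝓘(ℝ, E) 𝓘(ℝ, EH × F) ∞ (fun u => Φ.symm (φ u)) U :=
    (contMDiffOn_iff_contDiffOn.2 hΦ').comp
      ((contMDiffOn_chart (I := 𝓘(ℝ, E)) (n := ∞)).mono fun z hz => hz.1) fun z hz => hz.2.1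
  have hgU : ∀ u ∈ U, g (Φ.symm (φ u)) = u := by
    rintro u ⟨hu, hu', -⟩
    have h := Φ.right_inv hu'
    rw [hΦ] at h
    exact φ.injOn (hΦD (Φ.map_target hu')).2 hu h
  have hmem : ∀ v ∈ V, ((ψ 1, v) : EH × F) ∈ Φ.source := fun v hv =>
    hAV (Set.mk_mem_prod h1A hv.1)
  have hΦs : ∀ v, Φ (ψ 1, v) = φ (s v) := fun v => by rw [hΦ, Function.comp_apply, hg₁]
  have hsymm : ∀ v ∈ V, Φ.symm (φ (s v)) = (ψ 1, v) := fun v hv => by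
    rw [← hΦs, Φ.left_inv (hmem v hv)]
  have hsU : Set.MapsTo s V U := fun v hv => by
    refine ⟨hsφ v (hV₀B hv.1), ?_, ?_⟩
    · rw [← hΦs]
      exact Φ.map_source (hmem v hv)
    · rw [Set.mem_preimage, hsymm v hv]
      exact Set.mk_mem_prod h1A hv
  let S : SmoothSlice EH E F H X :=
    { U := U
      V := V
      shift := fun u => ψ.symm (Φ.symm (φ u)).1
      param := fun u => (Φ.symm (φ u)).2
      slice := s
      isOpen_U := hU
      isOpen_V := hV
      contMDiffOn_shift := (contMDiffOn_chart_symm (I := 𝓘(ℝ, EH)) (n := ∞)).comp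
        (contDiff_fst.contMDiff.comp_contMDiffOn hΦsymm)
        fun z hz => (hΦD (Φ.map_target hz.2.1)).1.1
      contMDiffOn_param := contDiff_snd.contMDiff.comp_contMDiffOn hΦsymm
      contMDiffOn_slice := hs.mono fun v hv => hV₀B hv.1
      mapsTo_param := fun u hu => hu.2.2.2
      mapsTo_slice := hsU
      param_slice := fun v hv => by simp only [hsymm v hv]
      shift_smul_slice := hgU
      param_smul := by
        intro a u hu hau
        have hu' : ψ.symm (Φ.symm (φ u)).1 • s (Φ.symm (φ u)).2 = u := hgU u hu
        have hau' : ψ.symm (Φ.symm (φ (a • u))).1 • s (Φ.symm (φ (a • u))).2 = a • u :=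
          hgU _ hau
        have hv : (Φ.symm (φ u)).2 ∈ V := hu.2.2.2
        have hv' : (Φ.symm (φ (a • u))).2 ∈ V := hau.2.2.2
        generalize (Φ.symm (φ u)).2 = v at *
        generalize (Φ.symm (φ (a • u))).2 = v' at *
        generalize ψ.symm (Φ.symm (φ u)).1 = h at *
        generalize ψ.symm (Φ.symm (φ (a • u))).1 = h' at *
        -- The element carrying one slice point to the other is close to the identity by the choice
        -- of `W`. Both coordinate pairs then lie where `Φ` is injective, so the parameters
        -- coincide.
        have hb : (h'⁻¹ * a * h) • s v = s v' := by
          rw [mul_smul, mul_smul, hu', ← hau', inv_smul_smul]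
        obtain ⟨hb₁, hb₂⟩ := hWN _ _ hv.2 (by rw [hb]; exact hv'.2)
        have key : Φ (ψ (h'⁻¹ * a * h), v) = Φ (ψ 1, v') := by
          rw [hΦs, hΦ, Function.comp_apply, ← hb]
          simp only [g, ψ.left_inv hb₁]
        exact (congrArg Prod.snd (Φ.injOn (hAV (Set.mk_mem_prod hb₂ hv.1)) (hmem v' hv')
          key)).symm }
  refine ⟨S, ?_⟩
  rw [← hs₀]
  exact hsU ⟨h0V, by rw [Set.mem_preimage, hs₀]; exact hxW⟩

end Slice

/-! ### The manifold structure of the orbit space. -/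

section QuotientManifold

open MulAction GroupoidOver Topology

theorem GroupoidOver.isOpenQuotientMap_orbitProj (H X : Type*) [Group H] [TopologicalSpace X]
    [MulAction H X] [ContinuousConstSMul H X] : IsOpenQuotientMap (orbitProj H X) :=
  MulAction.isOpenQuotientMap_quotientMk

/-- If `f : X → Y` is continuous and equivariant, the action on `Y` is proper and `X` is Hausdorff,
then the action on `X` is proper. -/
theorem ProperSMul.of_continuous_equivariant {H X Y : Type*} [Group H] [TopologicalSpace H]
    [TopologicalSpace X] [TopologicalSpace Y] [MulAction H X] [MulAction H Y] [ContinuousSMul H X]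
    [ProperSMul H Y] [T2Space X] {f : X → Y} (hf : Continuous f)
    (h : ∀ (a : H) (x : X), f (a • x) = a • f x) : ProperSMul H X := by
  refine properSMul_iff_continuousSMul_ultrafilter_tendsto_t2.2 ⟨inferInstance,
    fun 𝒰 x₁ x₂ hx => ?_⟩
  obtain ⟨-, hY⟩ := properSMul_iff_continuousSMul_ultrafilter_tendsto.1
    (inferInstance : ProperSMul H Y)
  -- Convergence of the group component involves only the group, so it can be read off from the
  -- image ultrafilter on `H × Y`, where properness applies.
  obtain ⟨a, -, ha⟩ := hY (𝒰.map (Prod.map id f)) (f x₁) (f x₂) (by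
    have h₁ := ((hf.prodMap hf).tendsto (x₁, x₂)).comp hx
    refine Filter.tendsto_map'_iff.2 ?_
    refine h₁.congr fun p => ?_
    simp [h])
  exact ⟨a, Filter.tendsto_map'_iff.1 ha⟩

variable {EH E F H X : Type*}
  [NormedAddCommGroup EH] [NormedSpace ℝ EH]
  [NormedAddCommGroup E] [NormedSpace ℝ E]
  [NormedAddCommGroup F] [NormedSpace ℝ F]
  [Group H] [TopologicalSpace H] [ChartedSpace EH H]
  [TopologicalSpace X] [ChartedSpace E X] [MulAction H X]

namespace SmoothSlice

theorem param_eq_of_orbitProj_eq (S : SmoothSlice EH E F H X) {u u' : X} (hu : u ∈ S.U)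
    (hu' : u' ∈ S.U) (h : orbitProj H X u = orbitProj H X u') : S.param u = S.param u' := by
  obtain ⟨a, rfl⟩ := orbitProj_eq_iff.1 h
  exact S.param_smul a u' hu' hu

theorem orbitProj_slice_param (S : SmoothSlice EH E F H X) {u : X} (hu : u ∈ S.U) :
    orbitProj H X (S.slice (S.param u)) = orbitProj H X u := by
  conv_rhs => rw [← S.shift_smul_slice u hu, orbitProj_smul]

open Classical in
/-- The parameter of an orbit meeting the domain of a slice. -/
noncomputable def orbitParam (S : SmoothSlice EH E F H X) (q : orbitRel.Quotient H X) : F :=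
  -- The value `0` on orbits missing `S.U` is arbitrary; such orbits lie outside the chart domain.
  if h : ∃ u ∈ S.U, orbitProj H X u = q then S.param h.choose else 0

theorem orbitParam_orbitProj (S : SmoothSlice EH E F H X) {u : X} (hu : u ∈ S.U) :
    S.orbitParam (orbitProj H X u) = S.param u := by
  have h : ∃ u' ∈ S.U, orbitProj H X u' = orbitProj H X u := ⟨u, hu, rfl⟩
  rw [orbitParam, dif_pos h]
  exact S.param_eq_of_orbitProj_eq h.choose_spec.1 hu h.choose_spec.2

variable [ContinuousConstSMul H X]

/-- The chart of the orbit space given by a slice. -/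
noncomputable def chart (S : SmoothSlice EH E F H X) :
    OpenPartialHomeomorph (orbitRel.Quotient H X) F where
  toFun := S.orbitParam
  invFun v := orbitProj H X (S.slice v)
  source := orbitProj H X '' S.U
  target := S.V
  map_source' := by
    rintro _ ⟨u, hu, rfl⟩
    rw [S.orbitParam_orbitProj hu]
    exact S.mapsTo_param hu
  map_target' v hv := ⟨_, S.mapsTo_slice hv, rfl⟩
  left_inv' := by
    rintro _ ⟨u, hu, rfl⟩
    rw [S.orbitParam_orbitProj hu, S.orbitProj_slice_param hu]
  right_inv' v hv := by
    rw [S.orbitParam_orbitProj (S.mapsTo_slice hv), S.param_slice v hv]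
  open_source := (isOpenQuotientMap_orbitProj H X).isOpenMap _ S.isOpen_U
  open_target := S.isOpen_V
  continuousOn_toFun := by
    rintro _ ⟨u, hu, rfl⟩
    refine ContinuousAt.continuousWithinAt ?_
    rw [← (isOpenQuotientMap_orbitProj H X).continuousAt_comp_iff]
    have h₁ : ContinuousAt S.param u :=
      S.contMDiffOn_param.continuousOn.continuousAt (S.isOpen_U.mem_nhds hu)
    refine h₁.congr ?_
    filter_upwards [S.isOpen_U.mem_nhds hu] with u' hu'
    exact (S.orbitParam_orbitProj hu').symm
  continuousOn_invFun := (isOpenQuotientMap_orbitProj H X).continuous.comp_continuousOn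
    S.contMDiffOn_slice.continuousOn

/-- The atlas of the orbit space given by slices through all points. -/
@[reducible]
noncomputable def chartedSpace (S : X → SmoothSlice EH E F H X) (hS : ∀ x, x ∈ (S x).U) :
    ChartedSpace F (orbitRel.Quotient H X) where
  atlas := Set.range fun x => (S x).chart
  chartAt q := (S q.out).chart
  mem_chart_source q := ⟨q.out, hS _, Quotient.out_eq q⟩
  chart_mem_atlas _ := ⟨_, rfl⟩

omit [ContinuousConstSMul H X] in
/-- The coordinate changes between slices are smooth. -/
theorem contDiffAt_orbitParam_slice [ContMDiffSMul 𝓘(ℝ, EH) 𝓘(ℝ, E) ∞ H X]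
    (S S' : SmoothSlice EH E F H X) {v : F} (hv : v ∈ S.V)
    (hv' : orbitProj H X (S.slice v) ∈ orbitProj H X '' S'.U) :
    ContDiffAt ℝ ∞ (fun v => S'.orbitParam (orbitProj H X (S.slice v))) v := by
  obtain ⟨u, hu, h⟩ := hv'
  -- One fixed `a` carries the slice of `S` into `S'.U` near `v`, by continuity. The coordinate
  -- change is then `S'.param (a • S.slice w)` for nearby `w`.
  obtain ⟨a, rfl⟩ := orbitProj_eq_iff.1 h
  have hs : ContMDiffAt 𝓘(ℝ, F) 𝓘(ℝ, E) ∞ (fun v => a • S.slice v) v :=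
    (contMDiff_smul_left EH E a).contMDiffAt.comp v
      (S.contMDiffOn_slice.contMDiffAt (S.isOpen_V.mem_nhds hv))
  have hp : ContMDiffAt 𝓘(ℝ, F) 𝓘(ℝ, F) ∞ (fun v => S'.param (a • S.slice v)) v :=
    (S'.contMDiffOn_param.contMDiffAt (S'.isOpen_U.mem_nhds hu)).comp v hs
  refine hp.contDiffAt.congr_of_eventuallyEq ?_
  filter_upwards [hs.continuousAt.preimage_mem_nhds (S'.isOpen_U.mem_nhds hu)] with w hw
  rw [← S'.orbitParam_orbitProj hw, orbitProj_smul]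

theorem isManifold [ContMDiffSMul 𝓘(ℝ, EH) 𝓘(ℝ, E) ∞ H X] (S : X → SmoothSlice EH E F H X)
    (hS : ∀ x, x ∈ (S x).U) :
    letI := chartedSpace S hS
    IsManifold 𝓘(ℝ, F) ∞ (orbitRel.Quotient H X) := by
  let := chartedSpace S hS
  refine isManifold_of_contDiffOn _ _ _ ?_
  rintro _ _ ⟨x, rfl⟩ ⟨x', rfl⟩ v ⟨hv, -⟩
  exact (contDiffAt_orbitParam_slice (S x) (S x') hv.1 hv.2).contDiffWithinAt

/-- In a slice chart the projection is `param`, hence smooth. Translating the slice by `shift x`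
gives a smooth local section through `x`, which forces the differential to be surjective there. -/
theorem isSubmersion_orbitProj [FiniteDimensional ℝ E] [FiniteDimensional ℝ F]
    [IsManifold 𝓘(ℝ, E) ∞ X] [ContMDiffSMul 𝓘(ℝ, EH) 𝓘(ℝ, E) ∞ H X]
    (S : X → SmoothSlice EH E F H X) (hS : ∀ x, x ∈ (S x).U) :
    letI := chartedSpace S hS
    Manifold.IsSubmersion 𝓘(ℝ, E) 𝓘(ℝ, F) ∞ (orbitProj H X) := by
  let := chartedSpace S hS
  have := isManifold S hS
  have hchart : ∀ x, (S x).chart ∈ IsManifold.maximalAtlas 𝓘(ℝ, F) ∞ (orbitRel.Quotient H X) :=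
    fun x => IsManifold.subset_maximalAtlas ⟨x, rfl⟩
  have hπ : ContMDiff 𝓘(ℝ, E) 𝓘(ℝ, F) ∞ (orbitProj H X) := by
    intro x
    have h₁ : ContMDiffAt 𝓘(ℝ, E) 𝓘(ℝ, F) ∞ (S x).param x :=
      (S x).contMDiffOn_param.contMDiffAt ((S x).isOpen_U.mem_nhds (hS x))
    refine ((contMDiffAt_symm_of_mem_maximalAtlas (hchart x)
      ((S x).mapsTo_param (hS x))).comp x h₁).congr_of_eventuallyEq ?_
    filter_upwards [(S x).isOpen_U.mem_nhds (hS x)] with u hu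
    exact ((S x).orbitProj_slice_param hu).symm
  refine hπ.isSubmersion fun x => ?_
  have hx : orbitProj H X x ∈ (S x).chart.source := ⟨x, hS x, rfl⟩
  have h₁ : (S x).chart (orbitProj H X x) = (S x).param x := (S x).orbitParam_orbitProj (hS x)
  have h₂ : ContMDiffAt 𝓘(ℝ, F) 𝓘(ℝ, E) ∞
      (fun q => (S x).shift x • (S x).slice ((S x).chart q)) (orbitProj H X x) := by
    refine (contMDiff_smul_left EH E _).contMDiffAt.comp _ (ContMDiffAt.comp _ ?_
      (contMDiffAt_of_mem_maximalAtlas (hchart x) hx))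
    exact (S x).contMDiffOn_slice.contMDiffAt
      ((S x).isOpen_V.mem_nhds ((S x).chart.map_source hx))
  refine (hπ.mdifferentiableAt (by simp)).surjective_mfderiv_of_section
    (h₂.mdifferentiableAt (by simp)) ?_ ?_
  · simp only [h₁, (S x).shift_smul_slice x (hS x)]
  · filter_upwards [(S x).chart.open_source.mem_nhds hx] with q hq
    rw [orbitProj_smul]
    exact (S x).chart.left_inv hq

end SmoothSlice

/-- The orbit space of a free proper smooth action is a manifold for which the projection is a
submersion. -/
theorem exists_quotientManifold (EH E : Type*) {F H X : Type*}
    [NormedAddCommGroup EH] [NormedSpace ℝ EH] [FiniteDimensional ℝ EH]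
    [NormedAddCommGroup E] [NormedSpace ℝ E] [FiniteDimensional ℝ E]
    [NormedAddCommGroup F] [NormedSpace ℝ F] [FiniteDimensional ℝ F]
    [Group H] [TopologicalSpace H] [ChartedSpace EH H] [LieGroup 𝓘(ℝ, EH) ∞ H]
    [TopologicalSpace X] [ChartedSpace E X] [IsManifold 𝓘(ℝ, E) ∞ X]
    [MulAction H X] [ContMDiffSMul 𝓘(ℝ, EH) 𝓘(ℝ, E) ∞ H X] [ProperSMul H X] [IsCancelSMul H X]
    (hF : Module.finrank ℝ F = Module.finrank ℝ E - Module.finrank ℝ EH) :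
    ∃ _ : ChartedSpace F (orbitRel.Quotient H X),
      IsManifold 𝓘(ℝ, F) ∞ (orbitRel.Quotient H X) ∧
      Manifold.IsSubmersion 𝓘(ℝ, E) 𝓘(ℝ, F) ∞ (orbitProj H X) := by
  choose S hS using fun x : X => exists_smoothSlice (EH := EH) (E := E) (F := F) (H := H) hF x
  exact ⟨SmoothSlice.chartedSpace S hS, SmoothSlice.isManifold S hS,
    SmoothSlice.isSubmersion_orbitProj S hS⟩

end QuotientManifold

/-! ### Maps of orbit spaces -/

section OrbitSpaceMaps

open MulAction GroupoidOver Topology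

/-- A map out of the base of a surjective submersion is smooth if its pull-back is. -/
theorem Manifold.IsSubmersion.contMDiff_of_comp {E E' E'' M N P : Type*}
    [NormedAddCommGroup E] [NormedSpace ℝ E] [NormedAddCommGroup E'] [NormedSpace ℝ E']
    [NormedAddCommGroup E''] [NormedSpace ℝ E''] [TopologicalSpace M] [ChartedSpace E M]
    [TopologicalSpace N] [ChartedSpace E' N] [TopologicalSpace P] [ChartedSpace E'' P]
    {π : M → N} (hπ : Manifold.IsSubmersion 𝓘(ℝ, E) 𝓘(ℝ, E') ∞ π) (hs : Function.Surjective π)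
    {g : N → P} (hg : ContMDiff 𝓘(ℝ, E) 𝓘(ℝ, E'') ∞ (g ∘ π)) :
    ContMDiff 𝓘(ℝ, E') 𝓘(ℝ, E'') ∞ g := by
  intro y
  obtain ⟨x, rfl⟩ := hs y
  obtain ⟨U, σ, hU, hxU, hσ, -, h⟩ := (hπ.isSubmersionAt x).exists_section
  refine ((hg.comp_contMDiffOn hσ).contMDiffAt (hU.mem_nhds hxU)).congr_of_eventuallyEq ?_
  filter_upwards [hU.mem_nhds hxU] with z hz
  simp [h z hz]

/-- For a free proper action, the group element moving a point to another one depends locally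
smoothly on the two points. -/
theorem exists_smooth_division (EH E : Type*) {H X : Type*}
    [NormedAddCommGroup EH] [NormedSpace ℝ EH] [FiniteDimensional ℝ EH]
    [NormedAddCommGroup E] [NormedSpace ℝ E] [FiniteDimensional ℝ E]
    [Group H] [TopologicalSpace H] [ChartedSpace EH H] [LieGroup 𝓘(ℝ, EH) ∞ H]
    [TopologicalSpace X] [ChartedSpace E X] [IsManifold 𝓘(ℝ, E) ∞ X]
    [MulAction H X] [ContMDiffSMul 𝓘(ℝ, EH) 𝓘(ℝ, E) ∞ H X] [ProperSMul H X] [IsCancelSMul H X]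
    (x : X) :
    ∃ (U : Set X) (δ : X × X → H), IsOpen U ∧ x ∈ U ∧
      ContMDiffOn (𝓘(ℝ, E).prod 𝓘(ℝ, E)) 𝓘(ℝ, EH) ∞ δ (U ×ˢ U) ∧
      ∀ (a : H), ∀ u ∈ U, a • u ∈ U → δ (a • u, u) = a := by
  obtain ⟨S, hS⟩ := exists_smoothSlice (EH := EH) (E := E) (H := H)
    (F := EuclideanSpace ℝ (Fin (Module.finrank ℝ E - Module.finrank ℝ EH))) (by simp) x
  -- Since `S.shift (a • u) = a * S.shift u`, the quotient of the two shifts recovers `a`.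
  refine ⟨S.U, fun p => S.shift p.1 * (S.shift p.2)⁻¹, S.isOpen_U, hS, ?_, fun a u hu hau => ?_⟩
  · exact (S.contMDiffOn_shift.comp contMDiffOn_fst fun p hp => hp.1).mul
      (S.contMDiffOn_shift.comp contMDiffOn_snd fun p hp => hp.2).inv
  · simp only [S.shift_smul a hu hau, mul_inv_cancel_right]

variable {EH EX EY EX' EY' H X Y : Type*}
  [NormedAddCommGroup EH] [NormedSpace ℝ EH]
  [NormedAddCommGroup EX] [NormedSpace ℝ EX] [NormedAddCommGroup EY] [NormedSpace ℝ EY]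
  [NormedAddCommGroup EX'] [NormedSpace ℝ EX'] [NormedAddCommGroup EY'] [NormedSpace ℝ EY']
  [Group H] [TopologicalSpace H] [ChartedSpace EH H]
  [TopologicalSpace X] [ChartedSpace EX X] [TopologicalSpace Y] [ChartedSpace EY Y]
  [MulAction H X] [MulAction H Y]
  [ChartedSpace EX' (orbitRel.Quotient H X)] [ChartedSpace EY' (orbitRel.Quotient H Y)]
  {f : X → Y} (hf : ∀ (a : H) (x : X), f (a • x) = a • f x)

omit [TopologicalSpace H] in
/-- The map of orbit spaces induced by a smooth map is smooth. -/
theorem contMDiff_orbitMap (hX : Manifold.IsSubmersion 𝓘(ℝ, EX) 𝓘(ℝ, EX') ∞ (orbitProj H X))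
    (hY : ContMDiff 𝓘(ℝ, EY) 𝓘(ℝ, EY') ∞ (orbitProj H Y))
    (hfs : ContMDiff 𝓘(ℝ, EX) 𝓘(ℝ, EY) ∞ f) :
    ContMDiff 𝓘(ℝ, EX') 𝓘(ℝ, EY') ∞ (orbitMap H f hf) :=
  hX.contMDiff_of_comp (orbitProj_surjective H X) (hY.comp hfs)

omit [TopologicalSpace H] in
/-- The map of orbit spaces induced by a submersion is a submersion. -/
theorem isSubmersion_orbitMap [FiniteDimensional ℝ EX'] [FiniteDimensional ℝ EY']
    [IsManifold 𝓘(ℝ, EX') ∞ (orbitRel.Quotient H X)]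
    [IsManifold 𝓘(ℝ, EY') ∞ (orbitRel.Quotient H Y)]
    (hX : Manifold.IsSubmersion 𝓘(ℝ, EX) 𝓘(ℝ, EX') ∞ (orbitProj H X))
    (hY : Manifold.IsSubmersion 𝓘(ℝ, EY) 𝓘(ℝ, EY') ∞ (orbitProj H Y))
    (hfs : Manifold.IsSubmersion 𝓘(ℝ, EX) 𝓘(ℝ, EY) ∞ f) :
    Manifold.IsSubmersion 𝓘(ℝ, EX') 𝓘(ℝ, EY') ∞ (orbitMap H f hf) := by
  have hs := contMDiff_orbitMap hf hX hY.contMDiff hfs.contMDiff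
  refine hs.isSubmersion fun y => ?_
  obtain ⟨x, rfl⟩ := orbitProj_surjective H X y
  have h₁ := mfderiv_comp x (hs.mdifferentiableAt (by simp) (x := orbitProj H X x))
    (hX.contMDiff.mdifferentiableAt (by simp))
  have h₂ := mfderiv_comp x (hY.contMDiff.mdifferentiableAt (by simp) (x := f x))
    (hfs.contMDiff.mdifferentiableAt (by simp))
  -- The same composite factors as `orbitMap H f hf ∘ orbitProj H X`, so surjectivity of its
  -- differential passes to the outer factor.
  have h₃ : Function.Surjective (mfderiv 𝓘(ℝ, EX) 𝓘(ℝ, EY') (orbitProj H Y ∘ f) x) := by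
    rw [h₂]
    exact (hY.isSubmersionAt _).surjective_mfderiv.comp (hfs.isSubmersionAt x).surjective_mfderiv
  have h₄ : Function.Surjective
      (mfderiv 𝓘(ℝ, EX) 𝓘(ℝ, EY') (orbitMap H f hf ∘ orbitProj H X) x) := h₃
  rw [h₁] at h₄
  exact Function.Surjective.of_comp h₄

variable [FiniteDimensional ℝ EH] [FiniteDimensional ℝ EY] [LieGroup 𝓘(ℝ, EH) ∞ H]
  [IsManifold 𝓘(ℝ, EY) ∞ Y] [ContMDiffSMul 𝓘(ℝ, EH) 𝓘(ℝ, EX) ∞ H X]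
  [ContMDiffSMul 𝓘(ℝ, EH) 𝓘(ℝ, EY) ∞ H Y] [ProperSMul H Y] [IsCancelSMul H Y]

include EH in
/-- A local section `τ` of `Y → Y / H` lifts along an equivariant map `f : X → Y` to a local section
of `X → X / H`. -/
theorem exists_section_over (hX : Manifold.IsSubmersion 𝓘(ℝ, EX) 𝓘(ℝ, EX') ∞ (orbitProj H X))
    (hY : ContMDiff 𝓘(ℝ, EY) 𝓘(ℝ, EY') ∞ (orbitProj H Y))
    (hfs : ContMDiff 𝓘(ℝ, EX) 𝓘(ℝ, EY) ∞ f) (x : X) {P : Set (orbitRel.Quotient H Y)}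
    {τ : orbitRel.Quotient H Y → Y} (hP : IsOpen P) (hxP : orbitProj H Y (f x) ∈ P)
    (hτ : ContMDiffOn 𝓘(ℝ, EY') 𝓘(ℝ, EY) ∞ τ P) (hτx : τ (orbitProj H Y (f x)) = f x)
    (hτP : ∀ p ∈ P, orbitProj H Y (τ p) = p) :
    ∃ (O : Set (orbitRel.Quotient H X)) (σ : orbitRel.Quotient H X → X), IsOpen O ∧
      orbitProj H X x ∈ O ∧ ContMDiffOn 𝓘(ℝ, EX') 𝓘(ℝ, EX) ∞ σ O ∧
      Set.MapsTo (orbitMap H f hf) O P ∧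
      ∀ y ∈ O, orbitProj H X (σ y) = y ∧ f (σ y) = τ (orbitMap H f hf y) := by
  obtain ⟨O, σ, hO, hxO, hσ, hσx, h⟩ := (hX.isSubmersionAt x).exists_section
  obtain ⟨U, δ, hU, hxU, hδ, hδU⟩ := exists_smooth_division EH EY (H := H) (f x)
  have hfh := contMDiff_orbitMap hf hX hY hfs
  have hτf : ContMDiffOn 𝓘(ℝ, EX') 𝓘(ℝ, EY) ∞ (fun y => τ (orbitMap H f hf y))
      (orbitMap H f hf ⁻¹' P) := hτ.comp hfh.contMDiffOn fun z hz => hz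
  have hfσ : ContMDiffOn 𝓘(ℝ, EX') 𝓘(ℝ, EY) ∞ (fun y => f (σ y)) O := hfs.comp_contMDiffOn hσ
  have hO₁ := hfσ.continuousOn.isOpen_inter_preimage hO hU
  have hO₂ := hτf.continuousOn.isOpen_inter_preimage (hP.preimage hfh.continuous) hU
  have hτ₂ : τ (orbitMap H f hf (orbitProj H X x)) = f x := hτx
  -- An arbitrary section `σ` is translated by the group element that carries `f (σ y)` to the
  -- prescribed point of the same orbit. Division makes this correction smooth.
  refine ⟨_, fun y => δ (τ (orbitMap H f hf y), f (σ y)) • σ y, hO₁.inter hO₂,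
    ⟨⟨hxO, ?_⟩, hxP, ?_⟩, ?_, fun y hy => hy.2.1, ?_⟩
  · simpa [hσx] using hxU
  · simpa [hτ₂] using hxU
  · refine (contMDiff_smul (I := 𝓘(ℝ, EH)) (I' := 𝓘(ℝ, EX)) (n := ∞)).comp_contMDiffOn
      (ContMDiffOn.prodMk ?_ (hσ.mono fun y hy => hy.1.1))
    exact hδ.comp ((hτf.mono fun y hy => hy.2.1).prodMk (hfσ.mono fun y hy => hy.1.1))
      fun y hy => ⟨hy.2.2, hy.1.2⟩
  · rintro y ⟨⟨hy, hyU⟩, hyP, hyU'⟩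
    refine ⟨by rw [orbitProj_smul, h y hy], ?_⟩
    have h₁ : orbitProj H Y (τ (orbitMap H f hf y)) = orbitProj H Y (f (σ y)) := by
      rw [hτP _ hyP, ← orbitMap_orbitProj H f hf, h y hy]
    obtain ⟨a, ha⟩ := orbitProj_eq_iff.1 h₁
    rw [hf, ← ha, hδU a _ hyU (by rw [ha]; exact hyU')]

include EH in
/-- A tangent vector to `X` is zero if its images in `Y` and `X / H` are zero. -/
theorem eq_zero_of_mfderiv_eq_zero
    (hX : Manifold.IsSubmersion 𝓘(ℝ, EX) 𝓘(ℝ, EX') ∞ (orbitProj H X))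
    (hf : ∀ (a : H) (x : X), f (a • x) = a • f x)
    (hfs : ContMDiff 𝓘(ℝ, EX) 𝓘(ℝ, EY) ∞ f) (x : X) (v : EX)
    (h₁ : mfderiv 𝓘(ℝ, EX) 𝓘(ℝ, EY) f x v = 0)
    (h₂ : mfderiv 𝓘(ℝ, EX) 𝓘(ℝ, EX') (orbitProj H X) x v = 0) : v = 0 := by
  obtain ⟨O, σ, hO, hxO, hσ, hσx, h⟩ := (hX.isSubmersionAt x).exists_section
  obtain ⟨U, δ, hU, hxU, hδ, hδU⟩ := exists_smooth_division EH EY (H := H) (f x)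
  have hfσ : ContMDiffOn 𝓘(ℝ, EX') 𝓘(ℝ, EY) ∞ (fun y => f (σ y)) O := hfs.comp_contMDiffOn hσ
  have hO₁ := hfσ.continuousOn.isOpen_inter_preimage hO hU
  -- `K` reconstructs a point near `x` from its image in `Y` and its orbit. It is a smooth local
  -- left inverse of `(f, π)`, so the differential of that pair is injective.
  let K : Y × orbitRel.Quotient H X → X := fun p => δ (p.1, f (σ p.2)) • σ p.2
  have hK : ContMDiffOn (𝓘(ℝ, EY).prod 𝓘(ℝ, EX')) 𝓘(ℝ, EX) ∞ K
      (U ×ˢ (O ∩ (fun y => f (σ y)) ⁻¹' U)) := by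
    refine (contMDiff_smul (I := 𝓘(ℝ, EH)) (I' := 𝓘(ℝ, EX)) (n := ∞)).comp_contMDiffOn
      (ContMDiffOn.prodMk ?_ (hσ.comp contMDiffOn_snd fun p hp => hp.2.1))
    exact hδ.comp (contMDiffOn_fst.prodMk (hfσ.comp contMDiffOn_snd fun p hp => hp.2.1))
      fun p hp => ⟨hp.1, hp.2.2⟩
  have hx : (f x, orbitProj H X x) ∈ U ×ˢ (O ∩ (fun y => f (σ y)) ⁻¹' U) :=
    ⟨hxU, hxO, by simpa [hσx] using hxU⟩
  have hKx : MDifferentiableAt (𝓘(ℝ, EY).prod 𝓘(ℝ, EX')) 𝓘(ℝ, EX) K (f x, orbitProj H X x) :=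
    (hK.contMDiffAt ((hU.prod hO₁).mem_nhds hx)).mdifferentiableAt (by simp)
  have hfx : MDifferentiableAt 𝓘(ℝ, EX) 𝓘(ℝ, EY) f x := hfs.mdifferentiableAt (by simp)
  have hπx : MDifferentiableAt 𝓘(ℝ, EX) 𝓘(ℝ, EX') (orbitProj H X) x :=
    hX.contMDiff.mdifferentiableAt (by simp)
  have hc := hKx.hasMFDerivAt.comp x (hfx.hasMFDerivAt.prodMk hπx.hasMFDerivAt)
  have hid : K ∘ (fun z => (f z, orbitProj H X z)) =ᶠ[𝓝 x] id := by
    have h₃ := (hfs.continuous.prodMk hX.contMDiff.continuous).continuousAt.preimage_mem_nhds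
      ((hU.prod hO₁).mem_nhds hx)
    filter_upwards [h₃] with z hz
    obtain ⟨hzU, hzO, hzU'⟩ := hz
    obtain ⟨a, ha⟩ := orbitProj_eq_iff.1 (h _ hzO).symm
    have h₄ : δ (f z, f (σ (orbitProj H X z))) = a := by
      have := hδU a (f (σ (orbitProj H X z))) hzU' (by rw [← hf, ha]; exact hzU)
      rwa [← hf, ha] at this
    simp only [K, Function.comp_apply, id, h₄, ha]
  have h₃ := DFunLike.congr_fun (hasMFDerivAt_unique hc
    ((hasMFDerivAt_id x).congr_of_eventuallyEq hid)) v
  refine h₃.symm.trans ?_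
  have h₄ : ((mfderiv 𝓘(ℝ, EX) 𝓘(ℝ, EY) f x).prod
      (mfderiv 𝓘(ℝ, EX) 𝓘(ℝ, EX') (orbitProj H X) x)) v = 0 := Prod.ext h₁ h₂
  exact (congrArg (mfderiv (𝓘(ℝ, EY).prod 𝓘(ℝ, EX')) 𝓘(ℝ, EX) K _) h₄).trans (map_zero _)

end OrbitSpaceMaps

/-! ### The quotient of a Lie groupoid -/

section QuotientGroupoid

open MulAction GroupoidOver Topology

variable {H G Q EH EG EQ EG' EQ' : Type*}
  [NormedAddCommGroup EH] [NormedSpace ℝ EH] [FiniteDimensional ℝ EH]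
  [NormedAddCommGroup EG] [NormedSpace ℝ EG]
  [NormedAddCommGroup EQ] [NormedSpace ℝ EQ] [FiniteDimensional ℝ EQ]
  [Group H] [TopologicalSpace H] [ChartedSpace EH H] [LieGroup 𝓘(ℝ, EH) ∞ H]
  [TopologicalSpace G] [ChartedSpace EG G]
  [TopologicalSpace Q] [ChartedSpace EQ Q] [IsManifold 𝓘(ℝ, EQ) ∞ Q]
  (𝒢 : GroupoidOver G Q) [IsLieGroupoid EG EQ 𝒢]
  [MulAction H G] [ContMDiffSMul 𝓘(ℝ, EH) 𝓘(ℝ, EG) ∞ H G]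
  [MulAction H Q] [ContMDiffSMul 𝓘(ℝ, EH) 𝓘(ℝ, EQ) ∞ H Q]
  [act : IsGroupoidAction H 𝒢] [IsCancelSMul H Q] [ProperSMul H Q]
  [NormedAddCommGroup EG'] [NormedSpace ℝ EG'] [NormedAddCommGroup EQ'] [NormedSpace ℝ EQ']
  [ChartedSpace EG' (orbitRel.Quotient H G)] [ChartedSpace EQ' (orbitRel.Quotient H Q)]
  (hG : Manifold.IsSubmersion 𝓘(ℝ, EG) 𝓘(ℝ, EG') ∞ (orbitProj H G))
  (hQ : Manifold.IsSubmersion 𝓘(ℝ, EQ) 𝓘(ℝ, EQ') ∞ (orbitProj H Q))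

include EH EQ hG in
/-- The product of the quotient groupoid is smooth. -/
theorem smooth_quotMul :
    SmoothOnSubmanifold (𝓘(ℝ, EG').prod 𝓘(ℝ, EG')) 𝓘(ℝ, EG') (𝒢.quotient H).composable
      fun p => (𝒢.quotient H).mul p.1.1 p.1.2 p.2 := by
  have hLie : IsLieGroupoid EG EQ 𝒢 := inferInstance
  rintro ⟨⟨x, y⟩, hxy⟩
  obtain ⟨⟨g, h⟩, e, rfl, rfl⟩ := exists_composable H 𝒢 x y hxy
  obtain ⟨O₁, σ₁, hO₁, hgO, hσ₁, hσ₁g, hπ₁⟩ := (hG.isSubmersionAt g).exists_section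
  obtain ⟨O₂, σ₂, hO₂, hhO, hσ₂, hσ₂h, hπ₂⟩ := (hG.isSubmersionAt h).exists_section
  obtain ⟨U, δ, hU, hgU, hδ, hδU⟩ := exists_smooth_division EH EQ (H := H) (𝒢.tgt g)
  obtain ⟨W, M, hW, hghW, hM, hMW⟩ := hLie.smooth_mul ⟨(g, h), e⟩
  have ht : ContMDiffOn 𝓘(ℝ, EG') 𝓘(ℝ, EQ) ∞ (fun x => 𝒢.tgt (σ₁ x)) O₁ :=
    hLie.isSubmersion_tgt.contMDiff.comp_contMDiffOn hσ₁
  have hs : ContMDiffOn 𝓘(ℝ, EG') 𝓘(ℝ, EQ) ∞ (fun x => 𝒢.src (σ₂ x)) O₂ :=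
    hLie.isSubmersion_src.contMDiff.comp_contMDiffOn hσ₂
  let D := (O₁ ∩ (fun x => 𝒢.tgt (σ₁ x)) ⁻¹' U) ×ˢ (O₂ ∩ (fun x => 𝒢.src (σ₂ x)) ⁻¹' U)
  have hD : IsOpen D := (ht.continuousOn.isOpen_inter_preimage hO₁ hU).prod
    (hs.continuousOn.isOpen_inter_preimage hO₂ hU)
  -- Lifts two classes to arrows, translating the second so that its source meets the target of the
  -- first whenever the classes are composable. It is smooth also off the composable pairs, so
  -- composing with the local extension `M` of the product gives the required extension downstairs.
  let Θ : orbitRel.Quotient H G × orbitRel.Quotient H G → G × G := fun p =>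
    (σ₁ p.1, δ (𝒢.tgt (σ₁ p.1), 𝒢.src (σ₂ p.2)) • σ₂ p.2)
  have hΘ : ContMDiffOn (𝓘(ℝ, EG').prod 𝓘(ℝ, EG')) (𝓘(ℝ, EG).prod 𝓘(ℝ, EG)) ∞ Θ D := by
    refine (hσ₁.comp contMDiffOn_fst fun p hp => hp.1.1).prodMk ?_
    refine (contMDiff_smul (I := 𝓘(ℝ, EH)) (I' := 𝓘(ℝ, EG)) (n := ∞)).comp_contMDiffOn
      (ContMDiffOn.prodMk ?_ (hσ₂.comp contMDiffOn_snd fun p hp => hp.2.1))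
    exact hδ.comp ((ht.comp contMDiffOn_fst fun p hp => hp.1.1).prodMk
      (hs.comp contMDiffOn_snd fun p hp => hp.2.1)) fun p hp => ⟨hp.1.2, hp.2.2⟩
  have hδ1 : δ (𝒢.tgt g, 𝒢.tgt g) = 1 := by
    have := hδU 1 (𝒢.tgt g) hgU (by rwa [one_smul])
    rwa [one_smul] at this
  have hΘgh : Θ (orbitProj H G g, orbitProj H G h) = (g, h) := by
    change (σ₁ (orbitProj H G g), δ (𝒢.tgt (σ₁ (orbitProj H G g)),
      𝒢.src (σ₂ (orbitProj H G h))) • σ₂ (orbitProj H G h)) = (g, h)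
    rw [hσ₁g, hσ₂h, ← show 𝒢.tgt g = 𝒢.src h from e, hδ1, one_smul]
  refine ⟨D ∩ Θ ⁻¹' W, fun p => orbitProj H G (M (Θ p)),
    hΘ.continuousOn.isOpen_inter_preimage hD hW, ⟨⟨⟨hgO, ?_⟩, hhO, ?_⟩, ?_⟩, ?_, ?_⟩
  · rwa [Set.mem_preimage, hσ₁g]
  · rwa [Set.mem_preimage, hσ₂h, ← show 𝒢.tgt g = 𝒢.src h from e]
  · rwa [Set.mem_preimage, hΘgh]
  · exact hG.contMDiff.comp_contMDiffOn (hM.comp (hΘ.mono Set.inter_subset_left) fun p hp => hp.2)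
  · rintro ⟨⟨x, y⟩, hxy'⟩ ⟨⟨⟨hx, hxU⟩, hy, hyU⟩, hW'⟩
    have h₁ : orbitProj H Q (𝒢.tgt (σ₁ x)) = orbitProj H Q (𝒢.src (σ₂ y)) := by
      have h₂ : quotTgt H 𝒢 x = quotSrc H 𝒢 y := hxy'
      rw [← hπ₁ x hx, ← hπ₂ y hy] at h₂
      exact h₂
    obtain ⟨a, ha⟩ := orbitProj_eq_iff.1 h₁
    have hδa : δ (𝒢.tgt (σ₁ x), 𝒢.src (σ₂ y)) = a := by
      have := hδU a _ hyU (by rw [ha]; exact hxU)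
      rwa [ha] at this
    have hΘxy : Θ (x, y) = (σ₁ x, a • σ₂ y) := by simp only [Θ, hδa]
    have hc : 𝒢.tgt (σ₁ x) = 𝒢.src (a • σ₂ y) := by rw [(act.isHom a).src, ha]
    have h₃ := hMW ⟨(σ₁ x, a • σ₂ y), hc⟩ (show (σ₁ x, a • σ₂ y) ∈ W from hΘxy ▸ (show Θ (x, y) ∈ W from hW'))
    have h₄ : orbitProj H G (a • σ₂ y) = y := by rw [orbitProj_smul, hπ₂ y hy]
    have h₅ : quotMul H 𝒢 x y hxy' = orbitProj H G (𝒢.mul (σ₁ x) (a • σ₂ y) hc) :=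
      (quotMul_congr H 𝒢 (hπ₁ x hx).symm h₄.symm hxy' (congrArg (orbitProj H Q) hc)).trans
        (quotMul_orbitProj H 𝒢 _ _ hc _)
    exact (congrArg (fun p => orbitProj H G (M p)) hΘxy).trans
      ((congrArg (orbitProj H G) h₃).trans h₅.symm)

include EH EG EQ hG hQ in
/-- The quotient of a Lie groupoid by a free proper action is a Lie groupoid. -/
theorem isLieGroupoid_quotient [FiniteDimensional ℝ EG'] [FiniteDimensional ℝ EQ']
    [IsManifold 𝓘(ℝ, EG') ∞ (orbitRel.Quotient H G)]
    [IsManifold 𝓘(ℝ, EQ') ∞ (orbitRel.Quotient H Q)] :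
    IsLieGroupoid EG' EQ' (𝒢.quotient H) where
  isSubmersion_src := isSubmersion_orbitMap (fun a g => (act.isHom a).src g) hG hQ
    (IsLieGroupoid.isSubmersion_src (EG := EG) (EQ := EQ) (𝒢 := 𝒢))
  isSubmersion_tgt := isSubmersion_orbitMap (fun a g => (act.isHom a).tgt g) hG hQ
    (IsLieGroupoid.isSubmersion_tgt (EG := EG) (EQ := EQ) (𝒢 := 𝒢))
  contMDiff_unit := contMDiff_orbitMap (fun a g => ((act.isHom a).unit g).symm) hQ hG.contMDiff
    (IsLieGroupoid.contMDiff_unit (EG := EG) (EQ := EQ) (𝒢 := 𝒢))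
  contMDiff_inv := contMDiff_orbitMap (fun a g => ((act.isHom a).inv g).symm) hG hG.contMDiff
    (IsLieGroupoid.contMDiff_inv (EG := EG) (EQ := EQ) (𝒢 := 𝒢))
  smooth_mul := smooth_quotMul (EH := EH) (EQ := EQ) 𝒢 hG

end QuotientGroupoid

/-! ### The Lie algebroid of the quotient -/

/-- The differential of a smooth map on an open set is smooth. -/
theorem ContMDiffOn.contMDiffOn_tangentMap {E E' M N : Type*} [NormedAddCommGroup E]
    [NormedSpace ℝ E] [NormedAddCommGroup E'] [NormedSpace ℝ E']
    [TopologicalSpace M] [ChartedSpace E M] [TopologicalSpace N] [ChartedSpace E' N]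
    [IsManifold 𝓘(ℝ, E) ∞ M] [IsManifold 𝓘(ℝ, E') ∞ N] {f : M → N} {s : Set M} (hs : IsOpen s)
    (hf : ContMDiffOn 𝓘(ℝ, E) 𝓘(ℝ, E') ∞ f s) :
    ContMDiffOn 𝓘(ℝ, E).tangent 𝓘(ℝ, E').tangent ∞ (tangentMap 𝓘(ℝ, E) 𝓘(ℝ, E') f)
      (Bundle.TotalSpace.proj ⁻¹' s) := by
  refine (hf.contMDiffOn_tangentMapWithin (m := ∞) (by simp) hs.uniqueMDiffOn).congr
    fun w hw => ?_
  exact (tangentMapWithin_eq_tangentMap (hs.uniqueMDiffOn _ hw)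
    ((hf.contMDiffAt (hs.mem_nhds hw)).mdifferentiableAt (by simp))).symm

/-- The inclusion of a tangent space into the tangent bundle is smooth. -/
theorem contMDiff_tangentBundle_mk {E M : Type*} [NormedAddCommGroup E] [NormedSpace ℝ E]
    [TopologicalSpace M] [ChartedSpace E M] [IsManifold 𝓘(ℝ, E) ∞ M] (x : M) :
    ContMDiff 𝓘(ℝ, E) 𝓘(ℝ, E).tangent ∞ (fun v : E => (⟨x, v⟩ : TangentBundle 𝓘(ℝ, E) M)) := by
  intro v
  rw [Bundle.contMDiffAt_totalSpace]
  refine ⟨contMDiffAt_const, contMDiffAt_id.congr_of_eventuallyEq (Filter.Eventually.of_forall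
    fun u => ?_)⟩
  -- The coordinate change from the chart at `x` to itself is the identity at `x`, so the fibre
  -- coordinate of `⟨x, u⟩` is `u`.
  have h := (tangentBundleCore 𝓘(ℝ, E) M).coordChange_self (achart E x) x
    (mem_achart_source E x) u
  rw [tangentBundleCore_coordChange_achart] at h
  simpa [TangentBundle.trivializationAt_apply] using h

section Algebroid

open MulAction GroupoidOver Topology

variable {H G Q EH EG EQ EG' EQ' : Type*}
  [NormedAddCommGroup EH] [NormedSpace ℝ EH] [FiniteDimensional ℝ EH]
  [NormedAddCommGroup EG] [NormedSpace ℝ EG]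
  [NormedAddCommGroup EQ] [NormedSpace ℝ EQ] [FiniteDimensional ℝ EQ]
  [Group H] [TopologicalSpace H] [ChartedSpace EH H] [LieGroup 𝓘(ℝ, EH) ∞ H]
  [TopologicalSpace G] [ChartedSpace EG G] [IsManifold 𝓘(ℝ, EG) ∞ G]
  [TopologicalSpace Q] [ChartedSpace EQ Q] [IsManifold 𝓘(ℝ, EQ) ∞ Q]
  (𝒢 : GroupoidOver G Q) [IsLieGroupoid EG EQ 𝒢]
  [MulAction H G] [ContMDiffSMul 𝓘(ℝ, EH) 𝓘(ℝ, EG) ∞ H G]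
  [MulAction H Q] [ContMDiffSMul 𝓘(ℝ, EH) 𝓘(ℝ, EQ) ∞ H Q]
  [act : IsGroupoidAction H 𝒢] [IsCancelSMul H Q] [ProperSMul H Q]
  [NormedAddCommGroup EG'] [NormedSpace ℝ EG'] [NormedAddCommGroup EQ'] [NormedSpace ℝ EQ']
  [ChartedSpace EG' (orbitRel.Quotient H G)] [IsManifold 𝓘(ℝ, EG') ∞ (orbitRel.Quotient H G)]
  [ChartedSpace EQ' (orbitRel.Quotient H Q)]
  [hquot : IsLieGroupoid EG' EQ' (𝒢.quotient H)]
  (hG : Manifold.IsSubmersion 𝓘(ℝ, EG) 𝓘(ℝ, EG') ∞ (orbitProj H G))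
  (hQ : Manifold.IsSubmersion 𝓘(ℝ, EQ) 𝓘(ℝ, EQ') ∞ (orbitProj H Q))

omit [IsManifold 𝓘(ℝ, EG) ∞ G] [IsManifold 𝓘(ℝ, EG') ∞ (orbitRel.Quotient H G)] in
include EH hG hQ in
/-- Near a unit, the projection `G → G / H` has a smooth section whose differential maps the Lie
algebroid of `G / H` to the one of `G`. -/
theorem exists_algebroid_section (q : Q) :
    ∃ (O : Set (orbitRel.Quotient H G)) (σ : orbitRel.Quotient H G → G), IsOpen O ∧
      orbitProj H G (𝒢.unit q) ∈ O ∧ ContMDiffOn 𝓘(ℝ, EG') 𝓘(ℝ, EG) ∞ σ O ∧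
      σ (orbitProj H G (𝒢.unit q)) = 𝒢.unit q ∧
      ∀ w ∈ (𝒢.quotient H).algebroid EG' EQ', w.proj ∈ O →
        tangentMap 𝓘(ℝ, EG') 𝓘(ℝ, EG) σ w ∈ 𝒢.algebroid EG EQ ∧
        tangentMap 𝓘(ℝ, EG) 𝓘(ℝ, EG') (orbitProj H G) (tangentMap 𝓘(ℝ, EG') 𝓘(ℝ, EG) σ w) = w := by
  have hLie : IsLieGroupoid EG EQ 𝒢 := inferInstance
  have hsrc := hLie.isSubmersion_src.contMDiff
  obtain ⟨P, τ, hP, hqP, hτ, hτq, hτP⟩ :=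
    (hQ.isSubmersionAt (𝒢.src (𝒢.unit q))).exists_section
  obtain ⟨O, σ, hO, hqO, hσ, hOP, h⟩ := exists_section_over (EH := EH)
    (fun (a : H) g => (act.isHom a).src g) hG hQ.contMDiff hsrc (𝒢.unit q) hP hqP hτ hτq hτP
  -- The arrows `σ (ε̂ p)` and `ε (τ p)` lie in one orbit and have the same source `τ p`; freeness
  -- on `Q` makes them equal.
  have hunit : ∀ p, (𝒢.quotient H).unit p ∈ O → σ ((𝒢.quotient H).unit p) = 𝒢.unit (τ p) := by
    intro p hp
    have h₀ : orbitMap H 𝒢.src (fun (a : H) g => (act.isHom a).src g)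
      ((𝒢.quotient H).unit p) = p := (𝒢.quotient H).src_unit p
    have hpP : p ∈ P := by
      have := hOP hp
      rwa [h₀] at this
    obtain ⟨h₁, h₂⟩ := h _ hp
    rw [h₀] at h₂
    have h₃ : orbitProj H G (σ ((𝒢.quotient H).unit p)) = orbitProj H G (𝒢.unit (τ p)) := by
      rw [h₁]
      conv_lhs => rw [← hτP p hpP]
      rfl
    obtain ⟨a, ha⟩ := orbitProj_eq_iff.1 h₃
    rw [← ha, (act.isHom a).src, 𝒢.src_unit] at h₂
    have ha1 : a = 1 := IsCancelSMul.right_cancel _ _ (τ p) (by rw [h₂, one_smul])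
    rw [← ha, ha1, one_smul]
  refine ⟨O, σ, hO, hqO, hσ, ?_, ?_⟩
  · rw [𝒢.src_unit] at hτq
    exact (hunit (orbitProj H Q q) hqO).trans (congrArg 𝒢.unit hτq)
  · rintro ⟨y, v⟩ ⟨⟨p, hp⟩, hv⟩ hy
    change y = _ at hp
    change y ∈ O at hy
    have hσy : MDifferentiableAt 𝓘(ℝ, EG') 𝓘(ℝ, EG) σ y :=
      (hσ.contMDiffAt (hO.mem_nhds hy)).mdifferentiableAt (by simp)
    refine ⟨⟨⟨τ p, ?_⟩, ?_⟩, ?_⟩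
    · change σ y = _
      rw [hp]
      exact hunit p (hp ▸ hy)
    · have h₁ : 𝒢.src ∘ σ =ᶠ[𝓝 y] τ ∘ (𝒢.quotient H).src := by
        filter_upwards [hO.mem_nhds hy] with z hz using (h z hz).2
      have hτy : MDifferentiableAt 𝓘(ℝ, EQ') 𝓘(ℝ, EQ) τ ((𝒢.quotient H).src y) :=
        (hτ.contMDiffAt (hP.mem_nhds (hOP hy))).mdifferentiableAt (by simp)
      have h₂ := h₁.mfderiv_eq (I := 𝓘(ℝ, EG')) (I' := 𝓘(ℝ, EQ))
      rw [mfderiv_comp (I' := 𝓘(ℝ, EG)) y (hsrc.mdifferentiableAt (by simp)) hσy,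
        mfderiv_comp (I' := 𝓘(ℝ, EQ')) y hτy
          (hquot.isSubmersion_src.contMDiff.mdifferentiableAt (by simp))] at h₂
      refine (DFunLike.congr_fun h₂ v).trans ?_
      exact (congrArg (mfderiv 𝓘(ℝ, EQ') 𝓘(ℝ, EQ) τ _) hv).trans (map_zero _)
    · have h₁ : orbitProj H G ∘ σ =ᶠ[𝓝 y] id := by
        filter_upwards [hO.mem_nhds hy] with z hz using (h z hz).1
      have h₂ := tangentMap_comp_at (I := 𝓘(ℝ, EG')) (I' := 𝓘(ℝ, EG)) (I'' := 𝓘(ℝ, EG'))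
        (⟨y, v⟩ : TangentBundle 𝓘(ℝ, EG') (orbitRel.Quotient H G))
        (hG.contMDiff.mdifferentiableAt (by simp)) hσy
      rw [← h₂]
      have h₃ : mfderiv 𝓘(ℝ, EG') 𝓘(ℝ, EG') (orbitProj H G ∘ σ) y = mfderiv 𝓘(ℝ, EG') 𝓘(ℝ, EG') id y :=
        h₁.mfderiv_eq
      rw [mfderiv_id] at h₃
      change (⟨(orbitProj H G ∘ σ) y, mfderiv 𝓘(ℝ, EG') 𝓘(ℝ, EG') (orbitProj H G ∘ σ) y v⟩ :
        TangentBundle 𝓘(ℝ, EG') (orbitRel.Quotient H G)) = ⟨y, v⟩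
      exact Bundle.TotalSpace.ext h₁.self_of_nhds (heq_of_eq (DFunLike.congr_fun h₃ v))

/-- The projection `AG → A(G / H)`. -/
noncomputable abbrev algebroidProj : 𝒢.algebroid EG EQ → (𝒢.quotient H).algebroid EG' EQ' :=
  algebroidMap (isLieHom_orbitProj 𝒢 hG.contMDiff hQ.contMDiff)

-- Every vector of `A(G / H)` sits over the class of a unit `ε(q)`, and `Tσ` for an adapted section
-- near that class provides a preimage.
omit [IsManifold 𝓘(ℝ, EG) ∞ G] [IsManifold 𝓘(ℝ, EG') ∞ (orbitRel.Quotient H G)] in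
include EH in
theorem algebroidProj_surjective : Function.Surjective (algebroidProj 𝒢 hG hQ) := by
  rintro ⟨w, hw⟩
  obtain ⟨p, hp⟩ := hw.1
  obtain ⟨q, rfl⟩ := orbitProj_surjective H Q p
  obtain ⟨O, σ, -, hqO, -, -, h⟩ := exists_algebroid_section (EH := EH) 𝒢 hG hQ q
  have := h w hw (hp ▸ hqO)
  exact ⟨⟨_, this.1⟩, Subtype.ext this.2⟩

omit [IsManifold 𝓘(ℝ, EG) ∞ G] [IsManifold 𝓘(ℝ, EG') ∞ (orbitRel.Quotient H G)]
  [FiniteDimensional ℝ EH] [FiniteDimensional ℝ EQ] [LieGroup 𝓘(ℝ, EH) ∞ H]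
  [IsManifold 𝓘(ℝ, EQ) ∞ Q] [ProperSMul H Q] in
theorem algebroidProj_smul (a : H) (w : 𝒢.algebroid EG EQ) :
    algebroidProj 𝒢 hG hQ (algebroidMap (isLieHom_smul EH EG EQ 𝒢 a) w) =
      algebroidProj 𝒢 hG hQ w := by
  refine Subtype.ext ?_
  have h := tangentMap_comp_at (I := 𝓘(ℝ, EG)) (I' := 𝓘(ℝ, EG)) (I'' := 𝓘(ℝ, EG'))
    (f := fun g : G => a • g) (g := orbitProj H G) w.1
    (hG.contMDiff.mdifferentiableAt (by simp))
    ((contMDiff_smul_left EH EG a).mdifferentiableAt (by simp))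
  refine h.symm.trans ?_
  have : orbitProj H G ∘ (fun g : G => a • g) = orbitProj H G :=
    funext fun g => orbitProj_smul H a g
  rw [this]
  rfl

-- Vectors with the same image sit over arrows in the same orbit. After a translation they sit over
-- the same arrow, and their difference is killed by `Tα` and by `Tπ_G`, hence is zero.
omit [IsManifold 𝓘(ℝ, EG) ∞ G] [IsManifold 𝓘(ℝ, EG') ∞ (orbitRel.Quotient H G)] in
theorem algebroidProj_eq_iff {w w' : 𝒢.algebroid EG EQ} :
    algebroidProj 𝒢 hG hQ w = algebroidProj 𝒢 hG hQ w' ↔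
      ∃ a : H, algebroidMap (isLieHom_smul EH EG EQ 𝒢 a) w' = w := by
  refine ⟨fun h => ?_, ?_⟩
  · have h₁ : orbitProj H G w.1.proj = orbitProj H G w'.1.proj :=
      congrArg (fun u => u.1.proj) h
    obtain ⟨a, ha⟩ := orbitProj_eq_iff.1 h₁
    refine ⟨a, ?_⟩
    rw [← algebroidProj_smul (EH := EH) 𝒢 hG hQ a w'] at h
    have hb : (algebroidMap (isLieHom_smul EH EG EQ 𝒢 a) w').1.proj = w.1.proj := ha
    generalize algebroidMap (isLieHom_smul EH EG EQ 𝒢 a) w' = w'' at h hb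
    obtain ⟨⟨g, v⟩, hg, hv⟩ := w
    obtain ⟨⟨g', v'⟩, hg', hv'⟩ := w''
    obtain rfl : g' = g := hb
    have h₂ : (mfderiv 𝓘(ℝ, EG) 𝓘(ℝ, EG') (orbitProj H G) g' : EG →L[ℝ] EG') v =
        (mfderiv 𝓘(ℝ, EG) 𝓘(ℝ, EG') (orbitProj H G) g' : EG →L[ℝ] EG') v' := by
      have := congrArg Subtype.val h
      exact eq_of_heq (Bundle.TotalSpace.mk.inj this).2
    have hv₁ : (mfderiv 𝓘(ℝ, EG) 𝓘(ℝ, EQ) 𝒢.src g' : EG →L[ℝ] EQ) v = 0 := hv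
    have hv₂ : (mfderiv 𝓘(ℝ, EG) 𝓘(ℝ, EQ) 𝒢.src g' : EG →L[ℝ] EQ) v' = 0 := hv'
    have h₃ := eq_zero_of_mfderiv_eq_zero (EH := EH) hG (fun a g => (act.isHom a).src g)
      (IsLieGroupoid.isSubmersion_src (EG := EG) (EQ := EQ) (𝒢 := 𝒢)).contMDiff g'
      ((v : EG) - (v' : EG))
      ((map_sub (mfderiv 𝓘(ℝ, EG) 𝓘(ℝ, EQ) 𝒢.src g' : EG →L[ℝ] EQ) v v').trans
        (by rw [hv₁, hv₂, sub_zero]))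
      ((map_sub (mfderiv 𝓘(ℝ, EG) 𝓘(ℝ, EG') (orbitProj H G) g' : EG →L[ℝ] EG') v v').trans
        (by rw [h₂, sub_self]))
    have h₄ : (v : EG) = v' := sub_eq_zero.1 h₃
    subst h₄
    rfl
  · rintro ⟨a, rfl⟩
    exact algebroidProj_smul (EH := EH) 𝒢 hG hQ a w'

omit [FiniteDimensional ℝ EQ] [TopologicalSpace H] [IsManifold 𝓘(ℝ, EQ) ∞ Q]
  [ProperSMul H Q] in
theorem continuous_algebroidProj : Continuous (algebroidProj 𝒢 hG hQ) :=
  ((hG.contMDiff.continuous_tangentMap (by simp)).comp continuous_subtype_val).subtype_mk _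

include EH in
/-- A map on `A(G / H)` is smooth if and only if its pull-back to `AG` is. -/
theorem smoothOnSubmanifold_comp_algebroidProj_iff {F HF N : Type*} [NormedAddCommGroup F]
    [NormedSpace ℝ F] [TopologicalSpace HF] {J : ModelWithCorners ℝ F HF}
    [TopologicalSpace N] [ChartedSpace HF N] (f : (𝒢.quotient H).algebroid EG' EQ' → N) :
    SmoothOnSubmanifold 𝓘(ℝ, EG').tangent J ((𝒢.quotient H).algebroid EG' EQ') f ↔
      SmoothOnSubmanifold 𝓘(ℝ, EG).tangent J (𝒢.algebroid EG EQ)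
        (fun w => f (algebroidProj 𝒢 hG hQ w)) := by
  refine ⟨fun hf w => ?_, fun hf w => ?_⟩
  · obtain ⟨U, F, hU, hwU, hF, hFU⟩ := hf (algebroidProj 𝒢 hG hQ w)
    have hT : ContMDiff 𝓘(ℝ, EG).tangent 𝓘(ℝ, EG').tangent ∞
        (tangentMap 𝓘(ℝ, EG) 𝓘(ℝ, EG') (orbitProj H G)) :=
      hG.contMDiff.contMDiff_tangentMap (by simp)
    exact ⟨_, _, hU.preimage hT.continuous, hwU, hF.comp hT.contMDiffOn fun z hz => hz,
      fun y hy => hFU (algebroidProj 𝒢 hG hQ y) hy⟩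
  · obtain ⟨p, hp⟩ := w.2.1
    obtain ⟨q, rfl⟩ := orbitProj_surjective H Q p
    obtain ⟨O, σ, hO, hqO, hσ, -, h⟩ := exists_algebroid_section (EH := EH) 𝒢 hG hQ q
    have hwO : w.1.proj ∈ O := hp ▸ hqO
    have hT := hσ.contMDiffOn_tangentMap hO
    obtain ⟨U, F, hU, hwU, hF, hFU⟩ := hf ⟨_, (h w.1 w.2 hwO).1⟩
    -- `Tσ` is a local section of `AG → A(G / H)`, so precomposing an extension of the pull-back
    -- with `Tσ` extends `f` itself.
    refine ⟨_, fun z => F (tangentMap 𝓘(ℝ, EG') 𝓘(ℝ, EG) σ z),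
      hT.continuousOn.isOpen_inter_preimage (hO.preimage (FiberBundle.continuous_proj _ _)) hU,
      ⟨hwO, hwU⟩, hF.comp (hT.mono Set.inter_subset_left) fun z hz => hz.2, fun y hy => ?_⟩
    obtain ⟨h₁, h₂⟩ := h y.1 y.2 hy.1
    refine (hFU ⟨_, h₁⟩ hy.2).trans (congrArg f (Subtype.ext h₂))

/-- The identification of `AG / H` with `A(G / H)`. -/
theorem exists_homeomorph_algebroid :
    letI : MulAction H (𝒢.algebroid EG EQ) := algebroidAction EH EG EQ 𝒢
    ∃ e : orbitRel.Quotient H (𝒢.algebroid EG EQ) ≃ₜ (𝒢.quotient H).algebroid EG' EQ',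
      ∀ w, e (orbitProj H (𝒢.algebroid EG EQ) w) = algebroidProj 𝒢 hG hQ w := by
  let _ : MulAction H (𝒢.algebroid EG EQ) := algebroidAction EH EG EQ 𝒢
  let f : orbitRel.Quotient H (𝒢.algebroid EG EQ) → (𝒢.quotient H).algebroid EG' EQ' :=
    Quotient.lift (algebroidProj 𝒢 hG hQ) fun w w' h =>
      (algebroidProj_eq_iff (EH := EH) 𝒢 hG hQ).2 h
  have hf : ∀ w, f (orbitProj H (𝒢.algebroid EG EQ) w) = algebroidProj 𝒢 hG hQ w := fun _ => rfl
  have hfc : Continuous f := (continuous_algebroidProj 𝒢 hG hQ).quotient_lift _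
  have hbij : Function.Bijective f := by
    refine ⟨fun x y hxy => ?_, fun w => ?_⟩
    · obtain ⟨w, rfl⟩ := orbitProj_surjective H _ x
      obtain ⟨w', rfl⟩ := orbitProj_surjective H _ y
      exact orbitProj_eq_iff.2 ((algebroidProj_eq_iff (EH := EH) 𝒢 hG hQ).1 hxy)
    · obtain ⟨w', rfl⟩ := algebroidProj_surjective (EH := EH) 𝒢 hG hQ w
      exact ⟨_, hf w'⟩
  let e := Equiv.ofBijective f hbij
  -- Locally the inverse is `Tσ` followed by the orbit projection of `AG`, and both are continuous.
  have he : Continuous e.symm := by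
    rw [continuous_iff_continuousAt]
    intro w
    obtain ⟨p, hp⟩ := w.2.1
    obtain ⟨q, rfl⟩ := orbitProj_surjective H Q p
    obtain ⟨O, σ, hO, hqO, hσ, -, h⟩ := exists_algebroid_section (EH := EH) 𝒢 hG hQ q
    have hwO : w.1.proj ∈ O := hp ▸ hqO
    have hO' : IsOpen {z : (𝒢.quotient H).algebroid EG' EQ' | z.1.proj ∈ O} :=
      hO.preimage ((FiberBundle.continuous_proj _ _).comp continuous_subtype_val)
    let s : {z : (𝒢.quotient H).algebroid EG' EQ' | z.1.proj ∈ O} → 𝒢.algebroid EG EQ :=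
      fun z => ⟨tangentMap 𝓘(ℝ, EG') 𝓘(ℝ, EG) σ z.1.1, (h z.1.1 z.1.2 z.2).1⟩
    have hs : Continuous s := ((hσ.contMDiffOn_tangentMap hO).continuousOn.comp_continuous
      (continuous_subtype_val.comp continuous_subtype_val) fun z => z.2).subtype_mk _
    have hes : e.symm ∘ Subtype.val = orbitProj H (𝒢.algebroid EG EQ) ∘ s := by
      funext z
      refine e.symm_apply_eq.2 ?_
      exact Subtype.ext (h z.1.1 z.1.2 z.2).2.symm
    refine (hO'.isOpenEmbedding_subtypeVal.continuousAt_iff (x := ⟨w, hwO⟩)).1 ?_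
    rw [hes]
    exact (continuous_quot_mk.comp hs).continuousAt
  exact ⟨{ toEquiv := e, continuous_toFun := hfc, continuous_invFun := he }, hf⟩

end Algebroid

/-! ### The induced discretization map -/

section Discretization

open MulAction GroupoidOver Topology

/-- The restriction of a smooth map on the Lie algebroid to a fibre is differentiable at `0`. -/
theorem mdifferentiableAt_comp_fibreIncl {EG EQ G Q : Type*}
    [NormedAddCommGroup EG] [NormedSpace ℝ EG] [NormedAddCommGroup EQ] [NormedSpace ℝ EQ]
    [TopologicalSpace G] [ChartedSpace EG G] [IsManifold 𝓘(ℝ, EG) ∞ G]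
    [TopologicalSpace Q] [ChartedSpace EQ Q] {𝒢 : GroupoidOver G Q} {R : 𝒢.algebroid EG EQ → G}
    (hR : SmoothOnSubmanifold 𝓘(ℝ, EG).tangent 𝓘(ℝ, EG) (𝒢.algebroid EG EQ) R) (q : Q) :
    MDifferentiableAt 𝓘(ℝ, 𝒢.fibre EG EQ q) 𝓘(ℝ, EG)
      (fun u => R (𝒢.fibreIncl EG EQ q u)) 0 := by
  obtain ⟨U, F, hU, hqU, hF, hFU⟩ := hR (𝒢.fibreIncl EG EQ q 0)
  have hi : ContMDiff 𝓘(ℝ, 𝒢.fibre EG EQ q) 𝓘(ℝ, EG).tangent ∞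
      (fun u => (𝒢.fibreIncl EG EQ q u).1) :=
    (contMDiff_tangentBundle_mk (𝒢.unit q)).comp (𝒢.fibre EG EQ q).subtypeL.contDiff.contMDiff
  have h : ContMDiffAt 𝓘(ℝ, 𝒢.fibre EG EQ q) 𝓘(ℝ, EG) ∞
      (fun u => F (𝒢.fibreIncl EG EQ q u).1) 0 :=
    (hF.contMDiffAt (hU.mem_nhds hqU)).comp (0 : 𝒢.fibre EG EQ q) hi.contMDiffAt
  refine (h.congr_of_eventuallyEq ?_).mdifferentiableAt (by simp)
  filter_upwards [hi.continuous.continuousAt.preimage_mem_nhds (hU.mem_nhds hqU)] with u hu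
  exact (hFU _ hu).symm

variable {H G Q EH EG EQ EG' EQ' : Type*}
  [NormedAddCommGroup EH] [NormedSpace ℝ EH] [FiniteDimensional ℝ EH]
  [NormedAddCommGroup EG] [NormedSpace ℝ EG]
  [NormedAddCommGroup EQ] [NormedSpace ℝ EQ] [FiniteDimensional ℝ EQ]
  [Group H] [TopologicalSpace H] [ChartedSpace EH H] [LieGroup 𝓘(ℝ, EH) ∞ H]
  [TopologicalSpace G] [ChartedSpace EG G] [IsManifold 𝓘(ℝ, EG) ∞ G]
  [TopologicalSpace Q] [ChartedSpace EQ Q] [IsManifold 𝓘(ℝ, EQ) ∞ Q]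
  (𝒢 : GroupoidOver G Q) [IsLieGroupoid EG EQ 𝒢]
  [MulAction H G] [ContMDiffSMul 𝓘(ℝ, EH) 𝓘(ℝ, EG) ∞ H G]
  [MulAction H Q] [ContMDiffSMul 𝓘(ℝ, EH) 𝓘(ℝ, EQ) ∞ H Q]
  [act : IsGroupoidAction H 𝒢] [IsCancelSMul H Q] [ProperSMul H Q]
  [NormedAddCommGroup EG'] [NormedSpace ℝ EG'] [NormedAddCommGroup EQ'] [NormedSpace ℝ EQ']
  [ChartedSpace EG' (orbitRel.Quotient H G)] [IsManifold 𝓘(ℝ, EG') ∞ (orbitRel.Quotient H G)]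
  [ChartedSpace EQ' (orbitRel.Quotient H Q)]
  [hquot : IsLieGroupoid EG' EQ' (𝒢.quotient H)]
  (hG : Manifold.IsSubmersion 𝓘(ℝ, EG) 𝓘(ℝ, EG') ∞ (orbitProj H G))
  (hQ : Manifold.IsSubmersion 𝓘(ℝ, EQ) 𝓘(ℝ, EQ') ∞ (orbitProj H Q))

/-- The differential of `π_G` at the unit `ε(q)`. -/
noncomputable def unitProjDeriv (EG EG' : Type*) [NormedAddCommGroup EG] [NormedSpace ℝ EG]
    [NormedAddCommGroup EG'] [NormedSpace ℝ EG'] {H G Q : Type*} [Group H] [MulAction H G]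
    [TopologicalSpace G] [ChartedSpace EG G] [ChartedSpace EG' (orbitRel.Quotient H G)]
    (𝒢 : GroupoidOver G Q) (q : Q) : EG →L[ℝ] EG' :=
  mfderiv 𝓘(ℝ, EG) 𝓘(ℝ, EG') (orbitProj H G) (𝒢.unit q)

omit [FiniteDimensional ℝ EH] [FiniteDimensional ℝ EQ] [TopologicalSpace H] [ProperSMul H Q]
  [IsManifold 𝓘(ℝ, EG) ∞ G] [IsManifold 𝓘(ℝ, EQ) ∞ Q]
  [IsManifold 𝓘(ℝ, EG') ∞ (orbitRel.Quotient H G)] in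
include hG hQ in
/-- The endomorphisms `Tε ∘ Tα` of `T_{ε(q)}G` and `T_{ε(π q)}(G / H)` are related by `Tπ_G`. -/
theorem unitProjDeriv_unitDeriv_srcDeriv (q : Q) (v : EG) :
    unitProjDeriv EG EG' (H := H) 𝒢 q (𝒢.unitDeriv EG EQ q (𝒢.srcDeriv EG EQ q v)) =
      (𝒢.quotient H).unitDeriv EG' EQ' (orbitProj H Q q)
        ((𝒢.quotient H).srcDeriv EG' EQ' (orbitProj H Q q) (unitProjDeriv EG EG' (H := H) 𝒢 q v)) := by
  have hLie : IsLieGroupoid EG EQ 𝒢 := inferInstance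
  have hε : MDifferentiable 𝓘(ℝ, EQ) 𝓘(ℝ, EG) 𝒢.unit :=
    hLie.contMDiff_unit.mdifferentiable (by simp)
  have hα : MDifferentiable 𝓘(ℝ, EG) 𝓘(ℝ, EQ) 𝒢.src := IsLieGroupoid.mdifferentiable_src
  have hε' : MDifferentiable 𝓘(ℝ, EQ') 𝓘(ℝ, EG') (𝒢.quotient H).unit :=
    hquot.contMDiff_unit.mdifferentiable (by simp)
  have hα' : MDifferentiable 𝓘(ℝ, EG') 𝓘(ℝ, EQ') (𝒢.quotient H).src :=
    IsLieGroupoid.mdifferentiable_src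
  have hπG : MDifferentiable 𝓘(ℝ, EG) 𝓘(ℝ, EG') (orbitProj H G) :=
    hG.contMDiff.mdifferentiable (by simp)
  have hπQ : MDifferentiable 𝓘(ℝ, EQ) 𝓘(ℝ, EQ') (orbitProj H Q) :=
    hQ.contMDiff.mdifferentiable (by simp)
  -- The two identities are the differentials of `π_G ∘ ε = ε̂ ∘ π_Q` and of `α̂ ∘ π_G = π_Q ∘ α`;
  -- chaining them gives the intertwining.
  have h₁ : (unitProjDeriv EG EG' (H := H) 𝒢 q).comp (𝒢.unitDeriv EG EQ q) =
      ((𝒢.quotient H).unitDeriv EG' EQ' (orbitProj H Q q)).comp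
        (mfderiv 𝓘(ℝ, EQ) 𝓘(ℝ, EQ') (orbitProj H Q) q) :=
    (mfderiv_comp q (hπG (𝒢.unit q)) (hε q)).symm.trans
      (mfderiv_comp q (hε' (orbitProj H Q q)) (hπQ q))
  have h₂ : ((𝒢.quotient H).srcDeriv EG' EQ' (orbitProj H Q q)).comp
      (unitProjDeriv EG EG' (H := H) 𝒢 q) =
      (mfderiv 𝓘(ℝ, EQ) 𝓘(ℝ, EQ') (orbitProj H Q) q : EQ →L[ℝ] EQ').comp
        (𝒢.srcDeriv EG EQ q) := by
    have h₃ : (mfderiv 𝓘(ℝ, EQ) 𝓘(ℝ, EQ') (orbitProj H Q) q : EQ →L[ℝ] EQ') =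
      mfderiv 𝓘(ℝ, EQ) 𝓘(ℝ, EQ') (orbitProj H Q) (𝒢.src (𝒢.unit q)) := by rw [𝒢.src_unit]
    rw [h₃]
    exact (mfderiv_comp (𝒢.unit q) (hα' (orbitProj H G (𝒢.unit q))) (hπG _)).symm.trans
      (mfderiv_comp (𝒢.unit q) (hπQ _) (hα _))
  have h₄ := DFunLike.congr_fun h₁ (𝒢.srcDeriv EG EQ q v)
  have h₅ := DFunLike.congr_fun h₂ v
  exact h₄.trans (congrArg ((𝒢.quotient H).unitDeriv EG' EQ' (orbitProj H Q q)) h₅.symm)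

include EH in
/-- A map on `A(G / H)` induced by a generalized discretization map on `G` is a generalized
discretization map. -/
theorem IsGeneralizedDiscretization.quotient {R : 𝒢.algebroid EG EQ → G}
    (hR : IsGeneralizedDiscretization EG EQ 𝒢 R)
    {R' : (𝒢.quotient H).algebroid EG' EQ' → orbitRel.Quotient H G}
    (h : ∀ w, R' (algebroidProj 𝒢 hG hQ w) = orbitProj H G (R w)) :
    IsGeneralizedDiscretization EG' EQ' (𝒢.quotient H) R' := by
  have hsmooth : SmoothOnSubmanifold 𝓘(ℝ, EG').tangent 𝓘(ℝ, EG')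
      ((𝒢.quotient H).algebroid EG' EQ') R' := by
    rw [smoothOnSubmanifold_comp_algebroidProj_iff (EH := EH) 𝒢 hG hQ]
    intro w
    obtain ⟨U, F, hU, hwU, hF, hFU⟩ := hR.smooth w
    exact ⟨U, fun z => orbitProj H G (F z), hU, hwU, hG.contMDiff.comp_contMDiffOn hF,
      fun y hy => (congrArg (orbitProj H G) (hFU y hy)).trans (h y).symm⟩
  have hincl : ∀ (q : Q) (v : 𝒢.fibre EG EQ q),
      ∃ hv : unitProjDeriv EG EG' (H := H) 𝒢 q v ∈ (𝒢.quotient H).fibre EG' EQ' (orbitProj H Q q),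
      (𝒢.quotient H).fibreIncl EG' EQ' (orbitProj H Q q)
        ⟨unitProjDeriv EG EG' (H := H) 𝒢 q v, hv⟩ =
      algebroidProj 𝒢 hG hQ (𝒢.fibreIncl EG EQ q v) := fun q v =>
    ⟨(algebroidProj 𝒢 hG hQ (𝒢.fibreIncl EG EQ q v)).2.2, rfl⟩
  refine ⟨hsmooth, fun p => ?_, fun p v' => ?_⟩
  · obtain ⟨q, rfl⟩ := orbitProj_surjective H Q p
    obtain ⟨hv, hv'⟩ := hincl q 0
    have h₀ : (⟨unitProjDeriv EG EG' (H := H) 𝒢 q (0 : 𝒢.fibre EG EQ q), hv⟩ :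
        (𝒢.quotient H).fibre EG' EQ' (orbitProj H Q q)) = 0 :=
      Subtype.ext (map_zero (unitProjDeriv EG EG' (H := H) 𝒢 q))
    rw [← h₀, hv', h, hR.zero]
    rfl
  · obtain ⟨q, rfl⟩ := orbitProj_surjective H Q p
    let ℓ : 𝒢.fibre EG EQ q →L[ℝ] (𝒢.quotient H).fibre EG' EQ' (orbitProj H Q q) :=
      ((unitProjDeriv EG EG' (H := H) 𝒢 q).comp (𝒢.fibre EG EQ q).subtypeL).codRestrict _
        fun v => (hincl q v).1
    have hℓ : ∀ v, ((ℓ v : (𝒢.quotient H).fibre EG' EQ' (orbitProj H Q q)) : EG') =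
      unitProjDeriv EG EG' (H := H) 𝒢 q v := fun v => rfl
    -- The fibre map `ℓ` is onto: the adapted section passes through `ε(q)`, so its differential
    -- lifts `v'` to a vector in the fibre over `q` itself.
    obtain ⟨v, rfl⟩ : ∃ v, ℓ v = v' := by
      obtain ⟨O, σ, -, hqO, -, hσq, hσ⟩ := exists_algebroid_section (EH := EH) 𝒢 hG hQ q
      obtain ⟨h₁, h₂⟩ := hσ _ ((𝒢.quotient H).fibreIncl EG' EQ' (orbitProj H Q q) v').2 hqO
      generalize hw : tangentMap 𝓘(ℝ, EG') 𝓘(ℝ, EG) σ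
        ((𝒢.quotient H).fibreIncl EG' EQ' (orbitProj H Q q) v').1 = w at h₁ h₂
      have hw₁ : w.proj = 𝒢.unit q := by
        rw [← hw]
        exact hσq
      obtain ⟨g, u⟩ := w
      obtain rfl : g = 𝒢.unit q := hw₁
      refine ⟨⟨u, h₁.2⟩, Subtype.ext ?_⟩
      exact eq_of_heq (Bundle.TotalSpace.mk.inj h₂).2
    -- The chain rule for `R'_{π q} ∘ ℓ = π_G ∘ R_q` at `0`, where `R_q 0 = ε(q)` identifies the
    -- base point of `Tπ_G`.
    have hd : (((𝒢.quotient H).fibreDeriv EG' EQ' R' (orbitProj H Q q)).comp ℓ :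
        𝒢.fibre EG EQ q →L[ℝ] EG') =
        (unitProjDeriv EG EG' (H := H) 𝒢 q).comp (𝒢.fibreDeriv EG EQ R q) := by
      have hR'd := mdifferentiableAt_comp_fibreIncl hsmooth (orbitProj H Q q)
      have hRd := mdifferentiableAt_comp_fibreIncl hR.smooth q
      have hfun : (fun u => R' ((𝒢.quotient H).fibreIncl EG' EQ' (orbitProj H Q q) u)) ∘ ℓ =
          orbitProj H G ∘ fun u => R (𝒢.fibreIncl EG EQ q u) := by
        funext u
        obtain ⟨hv, hv'⟩ := hincl q u
        exact (congrArg R' hv').trans (h _)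
      have hℓd : HasMFDerivAt 𝓘(ℝ, 𝒢.fibre EG EQ q)
          𝓘(ℝ, (𝒢.quotient H).fibre EG' EQ' (orbitProj H Q q)) ℓ 0 ℓ :=
        ℓ.hasFDerivAt.hasMFDerivAt
      have hR'd' := hR'd.hasMFDerivAt
      rw [← map_zero ℓ] at hR'd'
      have hπ : MDifferentiableAt 𝓘(ℝ, EG) 𝓘(ℝ, EG') (orbitProj H G)
        (R (𝒢.fibreIncl EG EQ q 0)) := hG.contMDiff.mdifferentiableAt (by simp)
      have h₁ := hR'd'.comp (0 : 𝒢.fibre EG EQ q) hℓd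
      have h₂ := hπ.hasMFDerivAt.comp (0 : 𝒢.fibre EG EQ q) hRd.hasMFDerivAt
      rw [hfun] at h₁
      have h₃ := hasMFDerivAt_unique h₁ h₂
      have h₄ : unitProjDeriv EG EG' (H := H) 𝒢 q = mfderiv 𝓘(ℝ, EG) 𝓘(ℝ, EG') (orbitProj H G)
        (R (𝒢.fibreIncl EG EQ q 0)) := by rw [hR.zero]; rfl
      rw [h₄]
      have h₅ : (𝒢.quotient H).fibreDeriv EG' EQ' R' (orbitProj H Q q) =
          mfderiv 𝓘(ℝ, (𝒢.quotient H).fibre EG' EQ' (orbitProj H Q q)) 𝓘(ℝ, EG')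
            (fun u => R' ((𝒢.quotient H).fibreIncl EG' EQ' (orbitProj H Q q) u)) (ℓ 0) := by
        rw [map_zero]; rfl
      rw [h₅]
      exact h₃
    have hdv : (𝒢.quotient H).fibreDeriv EG' EQ' R' (orbitProj H Q q) (ℓ v) =
        unitProjDeriv EG EG' (H := H) 𝒢 q (𝒢.fibreDeriv EG EQ R q v) := DFunLike.congr_fun hd v
    -- Every term is now the image under `Tπ_G` of the corresponding term of the identity for `R` at
    -- `v`.
    rw [hdv, hℓ, ← unitProjDeriv_unitDeriv_srcDeriv 𝒢 hG hQ, ← map_add, ← hR.deriv]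

end Discretization

/-! ### The theorem. -/

open GroupoidOver MulAction Module in
theorem mainTheorem5 {H G Q EH EG EQ : Type*}
    [NormedAddCommGroup EH] [NormedSpace ℝ EH] [FiniteDimensional ℝ EH]
    [NormedAddCommGroup EG] [NormedSpace ℝ EG] [FiniteDimensional ℝ EG]
    [NormedAddCommGroup EQ] [NormedSpace ℝ EQ] [FiniteDimensional ℝ EQ]
    [Group H] [TopologicalSpace H] [ChartedSpace EH H] [LieGroup 𝓘(ℝ, EH) ∞ H]
    [TopologicalSpace G] [T2Space G] [ChartedSpace EG G] [IsManifold 𝓘(ℝ, EG) ∞ G]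
    [TopologicalSpace Q] [T2Space Q] [ChartedSpace EQ Q] [IsManifold 𝓘(ℝ, EQ) ∞ Q]
    (𝒢 : GroupoidOver G Q) [IsLieGroupoid EG EQ 𝒢]
    [MulAction H G] [ContMDiffSMul 𝓘(ℝ, EH) 𝓘(ℝ, EG) ∞ H G]
    [MulAction H Q] [ContMDiffSMul 𝓘(ℝ, EH) 𝓘(ℝ, EQ) ∞ H Q]
    [IsGroupoidAction H 𝒢] [IsCancelSMul H Q] [ProperSMul H Q]
    (R : 𝒢.algebroid EG EQ → G) (hR : IsGeneralizedDiscretization EG EQ 𝒢 R)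
    (hequiv : ∀ (a : H) (w : 𝒢.algebroid EG EQ),
      R (algebroidMap (isLieHom_smul EH EG EQ 𝒢 a) w) = a • R w) :
    -- the quotient manifolds `G / H` and `Q / H` exist
    (T2Space (orbitRel.Quotient H G) ∧ T2Space (orbitRel.Quotient H Q) ∧
      (∃ _ : ChartedSpace (EuclideanSpace ℝ (Fin (finrank ℝ EG - finrank ℝ EH)))
          (orbitRel.Quotient H G),
        IsManifold (𝓡 (finrank ℝ EG - finrank ℝ EH)) ∞ (orbitRel.Quotient H G) ∧
        Manifold.IsSubmersion 𝓘(ℝ, EG) (𝓡 (finrank ℝ EG - finrank ℝ EH)) ∞ (orbitProj H G)) ∧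
      (∃ _ : ChartedSpace (EuclideanSpace ℝ (Fin (finrank ℝ EQ - finrank ℝ EH)))
          (orbitRel.Quotient H Q),
        IsManifold (𝓡 (finrank ℝ EQ - finrank ℝ EH)) ∞ (orbitRel.Quotient H Q) ∧
        Manifold.IsSubmersion 𝓘(ℝ, EQ) (𝓡 (finrank ℝ EQ - finrank ℝ EH)) ∞ (orbitProj H Q))) ∧
    -- for any quotient manifold structures on `G / H` and `Q / H`
    ∀ (EG' EQ' : Type*) [NormedAddCommGroup EG'] [NormedSpace ℝ EG'] [FiniteDimensional ℝ EG']
      [NormedAddCommGroup EQ'] [NormedSpace ℝ EQ'] [FiniteDimensional ℝ EQ']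
      [ChartedSpace EG' (orbitRel.Quotient H G)] [IsManifold 𝓘(ℝ, EG') ∞ (orbitRel.Quotient H G)]
      [ChartedSpace EQ' (orbitRel.Quotient H Q)] [IsManifold 𝓘(ℝ, EQ') ∞ (orbitRel.Quotient H Q)]
      (hG : Manifold.IsSubmersion 𝓘(ℝ, EG) 𝓘(ℝ, EG') ∞ (orbitProj H G))
      (hQ : Manifold.IsSubmersion 𝓘(ℝ, EQ) 𝓘(ℝ, EQ') ∞ (orbitProj H Q)),
      letI : MulAction H (𝒢.algebroid EG EQ) := algebroidAction EH EG EQ 𝒢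
      -- the quotient groupoid is a Lie groupoid, the projection `AG → A(G / H)` identifies the
      -- quotient `AG / H` with `A(G / H)` (as topological spaces and with their smooth functions),
      ∃ (_ : IsLieGroupoid EG' EQ' (𝒢.quotient H))
        (e : orbitRel.Quotient H (𝒢.algebroid EG EQ) ≃ₜ (𝒢.quotient H).algebroid EG' EQ'),
        (∀ w, e (orbitProj H (𝒢.algebroid EG EQ) w) =
          algebroidMap (isLieHom_orbitProj 𝒢 hG.contMDiff hQ.contMDiff) w) ∧
        (∀ f : (𝒢.quotient H).algebroid EG' EQ' → ℝ,
          SmoothOnSubmanifold 𝓘(ℝ, EG').tangent 𝓘(ℝ, ℝ) _ f ↔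
          SmoothOnSubmanifold 𝓘(ℝ, EG).tangent 𝓘(ℝ, ℝ) (𝒢.algebroid EG EQ)
            (fun w => f (e (orbitProj H (𝒢.algebroid EG EQ) w)))) ∧
        -- and the induced map `AG / H → G / H` is a generalized discretization map
        IsGeneralizedDiscretization EG' EQ' (𝒢.quotient H)
          (orbitMap H R hequiv ∘ e.symm) := by
  have hGc : ContinuousSMul H G := ContMDiffSMul.continuousSMul (I := 𝓘(ℝ, EH)) (I' := 𝓘(ℝ, EG)) ∞
  have hLie : IsLieGroupoid EG EQ 𝒢 := inferInstance
  have act : IsGroupoidAction H 𝒢 := inferInstance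
  have hsrc : ∀ (a : H) (g : G), 𝒢.src (a • g) = a • 𝒢.src g := fun a g => (act.isHom a).src g
  -- Properness and freeness on `G` are inherited from `Q` along the equivariant source map.
  have hGp : ProperSMul H G :=
    .of_continuous_equivariant hLie.isSubmersion_src.contMDiff.continuous hsrc
  have hGf : IsCancelSMul H G := ⟨fun a b g h => IsCancelSMul.right_cancel a b (𝒢.src g) (by
    rw [← hsrc, h, hsrc])⟩
  refine ⟨⟨t2Space_quotient_mulAction_of_properSMul, t2Space_quotient_mulAction_of_properSMul,
    exists_quotientManifold EH EG (by simp), exists_quotientManifold EH EQ (by simp)⟩, ?_⟩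
  intro EG' EQ' _ _ _ _ _ _ _ _ _ _ hG hQ
  let _ : MulAction H (𝒢.algebroid EG EQ) := algebroidAction EH EG EQ 𝒢
  have hquot : IsLieGroupoid EG' EQ' (𝒢.quotient H) :=
    isLieGroupoid_quotient (EH := EH) 𝒢 hG hQ
  obtain ⟨e, he⟩ := exists_homeomorph_algebroid (EH := EH) 𝒢 hG hQ
  refine ⟨hquot, e, he, fun f => ?_, ?_⟩
  · rw [smoothOnSubmanifold_comp_algebroidProj_iff (EH := EH) 𝒢 hG hQ]
    simp only [he]
  · refine IsGeneralizedDiscretization.quotient (EH := EH) 𝒢 hG hQ hR fun w => ?_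
    rw [← he, Function.comp_apply, e.symm_apply_apply]
    rfl
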